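/- Let $\mathbb K=\mathbb R$ or $\mathbb C$, let $n\ge 3$, and let $\mathcal F(\mathbb K^n)$ denote the algebra of germs at $0$ of functions on $\mathbb K^n$ of one of the following kinds: $C^\infty$ (for $\mathbb K=\mathbb R$), analytic (holomorphic for $\mathbb K=\mathbb C$), or formal power series. Let $\Omega^k(\mathbb K^n)$, $\mathcal X^k(\mathbb K^n)$ be the spaces of $k$-forms and $k$-vectors with coefficients in $\mathcal F(\mathbb K^n)$, and put $\omega=dx_1\wedge\dots\wedge dx_n$. Let $w_1,\dots,w_n$ be positive integers, and let $f\in\mathbb K[x_1,\dots,x_n]$ be quasihomogeneous of degree $N$ for the weights $w_1,\dots,w_n$, with $f(0)=0$. Assume that $f$ is of finite codimension, i.e. that $Q_f=\mathcal F(\mathbb K^n)/(\partial f/\partial x_1,\dots,\partial f/\partial x_n)$ has finite dimension $c$ over $\mathbb K$. Put $\Lambda=f\,\frac{\partial}{\partial x_1}\wedge\dots\wedge\frac{\partial}{\partial x_n}$, let $s$ be the dimension of the space of quasihomogeneous polynomials of degree $N-\sum_i w_i$ (so $s=0$ if there is no monomial of that degree), let $$B^n_{f,n-2}(\mathbb K^n)=\{f\,d\beta-df\wedge\beta\;:\;\beta\in\Omega^{n-1}(\mathbb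 K^n)\},$$ and let $H^2_\Lambda(\mathbb K^n)=\mathcal X^n(\mathbb K^n)/\{[X,\Lambda]: X\in\mathcal X^1(\mathbb K^n)\}$, where $[\,,]$ is the Schouten bracket. 1. Let $\mathcal B$ be any monomial basis of $Q_f$ (a set of monomials whose classes form a basis of $Q_f$). For every $\alpha\in\Omega^n(\mathbb K^n)$ there exist unique polynomials $h_1,h_2$ (possibly zero) such that $h_1$ is quasihomogeneous of degree $N-\sum_i w_i$, $h_2$ is a linear combination of monomials of $\mathcal B$, and $$\alpha=(h_2+f h_1)\,\omega \quad \mathrm{mod}\ B^n_{f,n-2}(\mathbb K^n).$$ 2. The space $H^2_\Lambda(\mathbb K^n)$ is finite dimensional, of dimension $c+s$. 3. $H^2_\Lambda(\mathbb K^n)$ describes the infinitesimal deformations of $\Lambda$: call two first-order deformations $\Lambda+\varepsilon\Pi$ and $\Lambda+\varepsilon\Pi'$ ($\varepsilon^2=0$, $\Pi,\Pi'\in\mathcal X^n(\mathbb K^n)$) equivalent if some infinitesimal change of coordinates $\mathrm{id}+\varepsilon X$, $X\in\mathcal X^1(\mathbb K^n)$, carries the $n$-ary bracket $\{g_1,\dots,g_n\}$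 of the first to that of the second. Then $\Lambda+\varepsilon\Pi\mapsto[\Pi]\in H^2_\Lambda(\mathbb K^n)$ is surjective, and two deformations have the same image if and only if they are equivalent. -/

import Mathlib

open Filter Topology
open scoped ContDiff

noncomputable section

namespace NambuGerm

/-! ### The four local function algebras

`𝕜` is `ℝ` or `ℂ`.  Germs at `0` of functions `𝕜ⁿ → 𝕜` which are `C^m` over `𝕜` near `0`
(`m = ∞`: smooth, `m = ω`: analytic; over `ℂ` both give the holomorphic germs), and formal
power series. -/

section Germs

variable (𝕜 : Type*) [RCLike 𝕜] (n : ℕ)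

instance germAlgebra (l : Filter (Fin n → 𝕜)) : Algebra 𝕜 (Germ l 𝕜) :=
  Algebra.ofModule
    (fun r x y => by
      induction x using Germ.inductionOn with | _ x => ?_
      induction y using Germ.inductionOn with | _ y => ?_
      exact congrArg _ (smul_mul_assoc r x y))
    (fun r x y => by
      induction x using Germ.inductionOn with | _ x => ?_
      induction y using Germ.inductionOn with | _ y => ?_
      exact congrArg _ (mul_smul_comm r x y))

/-- Germs at `0` of functions of class `C^m` on a neighbourhood of `0` in `𝕜ⁿ`. -/
def germs (m : ℕ∞ω) : Subalgebra 𝕜 (Germ (𝓝 (0 : Fin n → 𝕜)) 𝕜) where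
  carrier := {g | ∃ φ : (Fin n → 𝕜) → 𝕜, (∀ᶠ x in 𝓝 0, ContDiffAt 𝕜 m φ x) ∧ (φ : Germ _ 𝕜) = g}
  mul_mem' := by
    rintro _ _ ⟨φ, hφ, rfl⟩ ⟨ψ, hψ, rfl⟩
    exact ⟨φ * ψ, by filter_upwards [hφ, hψ] with x h₁ h₂ using h₁.mul h₂, rfl⟩
  add_mem' := by
    rintro _ _ ⟨φ, hφ, rfl⟩ ⟨ψ, hψ, rfl⟩
    exact ⟨φ + ψ, by filter_upwards [hφ, hψ] with x h₁ h₂ using h₁.add h₂, rfl⟩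
  algebraMap_mem' c := by
    refine ⟨c • (1 : (Fin n → 𝕜) → 𝕜), Eventually.of_forall fun x => ?_, ?_⟩
    · exact contDiffAt_const (c := c • (1 : 𝕜))
    · rw [Algebra.algebraMap_eq_smul_one]; rfl

/-- The partial derivative `∂/∂xᵢ` of an arbitrary germ (meaningful on differentiable ones). -/
def germPartial (i : Fin n) :
    Germ (𝓝 (0 : Fin n → 𝕜)) 𝕜 → Germ (𝓝 (0 : Fin n → 𝕜)) 𝕜 :=
  Germ.map' (fun φ x => fderiv 𝕜 φ x (Pi.single i 1)) fun φ ψ (h : φ =ᶠ[𝓝 0] ψ) => by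
    filter_upwards [h.fderiv (𝕜 := 𝕜)] with x hx
    rw [hx]

theorem germPartial_coe (i : Fin n) (φ : (Fin n → 𝕜) → 𝕜) :
    germPartial 𝕜 n i (Germ.ofFun φ) = Germ.ofFun fun x => fderiv 𝕜 φ x (Pi.single i 1) := rfl

theorem ne_zero_of_add_one_le {m : ℕ∞ω} (hm : m + 1 ≤ m) : m ≠ 0 := by
  rintro rfl
  simp at hm

/-- The partial derivative `∂/∂xᵢ` as a derivation of the algebra of `C^m` germs,
`m ∈ {∞, ω}`. -/
def germsPartial {m : ℕ∞ω} (hm : m + 1 ≤ m) (i : Fin n) :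
    Derivation 𝕜 (germs 𝕜 n m) (germs 𝕜 n m) :=
  Derivation.mk'
    { toFun := fun g => ⟨germPartial 𝕜 n i g, by
        obtain ⟨_, φ, hφ, rfl⟩ := g
        refine ⟨fun x => fderiv 𝕜 φ x (Pi.single i 1), ?_, rfl⟩
        filter_upwards [hφ] with x hx
        exact (hx.fderiv_right hm).clm_apply contDiffAt_const⟩
      map_add' := by
        rintro ⟨_, φ, hφ, rfl⟩ ⟨_, ψ, hψ, rfl⟩
        refine Subtype.ext (Germ.coe_eq.2 ?_)
        filter_upwards [hφ, hψ] with x h₁ h₂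
        have h₁' := h₁.differentiableAt (ne_zero_of_add_one_le hm)
        have h₂' := h₂.differentiableAt (ne_zero_of_add_one_le hm)
        exact congrArg (fun L => L (Pi.single i 1)) (fderiv_add h₁' h₂')
      map_smul' := by
        rintro c ⟨_, φ, hφ, rfl⟩
        refine Subtype.ext (Germ.coe_eq.2 ?_)
        filter_upwards [hφ] with x h₁
        have h₁' := h₁.differentiableAt (ne_zero_of_add_one_le hm)
        exact congrArg (fun L => L (Pi.single i 1)) (fderiv_const_smul h₁' c) }
    (by
      rintro ⟨_, φ, hφ, rfl⟩ ⟨_, ψ, hψ, rfl⟩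
      refine Subtype.ext (Germ.coe_eq.2 ?_)
      filter_upwards [hφ, hψ] with x h₁ h₂
      have h₁' := h₁.differentiableAt (ne_zero_of_add_one_le hm)
      have h₂' := h₂.differentiableAt (ne_zero_of_add_one_le hm)
      exact congrArg (fun L => L (Pi.single i 1)) (fderiv_mul h₁' h₂'))

/-- The coordinate function `xᵢ` as a `C^m` germ. -/
def germsCoord (m : ℕ∞ω) (i : Fin n) : germs 𝕜 n m :=
  ⟨((fun x => x i : (Fin n → 𝕜) → 𝕜) : Germ _ 𝕜), fun x => x i,
    Eventually.of_forall fun _ => contDiffAt_apply (𝕜 := 𝕜) (E := 𝕜) i _, rfl⟩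

end Germs

/-- The kinds of germs of functions: `C^∞` over `𝕜`, analytic over `𝕜`, formal power series. -/
inductive Kind
  | smooth
  | analytic
  | formal

section Functions

variable (r : Kind) (𝕜 : Type*) [RCLike 𝕜] (n : ℕ)

/-- The algebra `𝓕(𝕜ⁿ)` of germs at `0` of functions of the given kind. -/
def Fn : Type _ :=
  match r with
  | .smooth => germs 𝕜 n ∞
  | .analytic => germs 𝕜 n ω
  | .formal => MvPowerSeries (Fin n) 𝕜

instance : CommRing (Fn r 𝕜 n) :=
  match r with
  | .smooth => inferInstanceAs (CommRing (germs 𝕜 n ∞))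
  | .analytic => inferInstanceAs (CommRing (germs 𝕜 n ω))
  | .formal => inferInstanceAs (CommRing (MvPowerSeries (Fin n) 𝕜))

instance : Algebra 𝕜 (Fn r 𝕜 n) :=
  match r with
  | .smooth => inferInstanceAs (Algebra 𝕜 (germs 𝕜 n ∞))
  | .analytic => inferInstanceAs (Algebra 𝕜 (germs 𝕜 n ω))
  | .formal => inferInstanceAs (Algebra 𝕜 (MvPowerSeries (Fin n) 𝕜))

/-- The partial derivatives `∂/∂xᵢ` on `𝓕(𝕜ⁿ)`. -/
def pd (i : Fin n) : Derivation 𝕜 (Fn r 𝕜 n) (Fn r 𝕜 n) :=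
  match r with
  | .smooth => germsPartial 𝕜 n (m := ∞) le_rfl i
  | .analytic => germsPartial 𝕜 n (m := ω) le_rfl i
  | .formal => MvPowerSeries.pderiv 𝕜 i

/-- The coordinate functions `xᵢ` in `𝓕(𝕜ⁿ)`. -/
def coord (i : Fin n) : Fn r 𝕜 n :=
  match r with
  | .smooth => germsCoord 𝕜 n ∞ i
  | .analytic => germsCoord 𝕜 n ω i
  | .formal => (MvPowerSeries.X i : MvPowerSeries (Fin n) 𝕜)

variable {𝕜 n}

/-- A polynomial regarded as an element of `𝓕(𝕜ⁿ)`. -/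
def poly : MvPolynomial (Fin n) 𝕜 →ₐ[𝕜] Fn r 𝕜 n :=
  MvPolynomial.aeval (coord r 𝕜 n)

end Functions

/-! ### Differential calculus over a function algebra

Throughout, `A` is a `K`-algebra of functions of `n` variables and `D i : A → A` is the partial
derivative `∂/∂xᵢ`.  A vector field `∑ Xᵢ ∂/∂xᵢ` and a 1-form `∑ θᵢ dxᵢ` are given by their
coefficients in `Fin n → A`. -/

section Calculus

variable {K A : Type*} [CommRing K] [CommRing A] [Algebra K A] {n : ℕ}

/-- The derivation `g ↦ X.g = ∑ Xᵢ ∂g/∂xᵢ` defined by a vector field. -/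
def vf (D : Fin n → Derivation K A A) (X : Fin n → A) : Derivation K A A := ∑ i, X i • D i

theorem vf_apply (D : Fin n → Derivation K A A) (X : Fin n → A) (g : A) :
    vf D X g = ∑ i, X i * D i g := by
  have h : ∀ s : Finset (Fin n), (∑ i ∈ s, X i • D i) g = ∑ i ∈ s, X i * D i g := by
    intro s
    induction s using Finset.induction_on with
    | empty => simp
    | insert a s ha ih => rw [Finset.sum_insert ha, Finset.sum_insert ha, ← ih]; simp
  exact h _

variable (A n) in
/-- `Ω^k`: alternating `A`-multilinear forms on vector fields. -/
abbrev Form (k : ℕ) := (Fin n → A) [⋀^Fin k]→ₗ[A] A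

variable (A n) in
/-- `𝓧^k`: alternating `A`-multilinear forms on 1-forms. -/
abbrev MultiVector (k : ℕ) := (Fin n → A) [⋀^Fin k]→ₗ[A] A

variable (A n) in
/-- The volume form `ω = dx₁ ∧ … ∧ dxₙ`. -/
def vol : Form A n n := (Pi.basisFun A (Fin n)).det

variable (A n) in
/-- The `n`-vector `∂/∂x₁ ∧ … ∧ ∂/∂xₙ`. -/
def unitMultiVector : MultiVector A n n := (Pi.basisFun A (Fin n)).det

/-- The derivative of an alternating form `α` along a derivation `δ` of `A` and a compatible
operator `T` on its arguments:
`(v₁, …, v_k) ↦ δ (α (v₁, …, v_k)) - ∑ₛ α (v₁, …, T vₛ, …, v_k)`. -/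
def deriveAlt {M : Type*} [AddCommGroup M] [Module A M] {k : ℕ} (δ : Derivation K A A)
    (T : M →+ M) (hT : ∀ (a : A) (v : M), T (a • v) = a • T v + δ a • v)
    (α : M [⋀^Fin k]→ₗ[A] A) : M [⋀^Fin k]→ₗ[A] A :=
  { toFun := fun v => δ (α v) - ∑ s, α (Function.update v s (T (v s)))
    map_update_add' := by
      intro inst v s x y
      obtain rfl : inst = instDecidableEqFin k := Subsingleton.elim _ _
      rw [← Finset.add_sum_erase _ _ (Finset.mem_univ s),
        ← Finset.add_sum_erase _ _ (Finset.mem_univ s),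
        ← Finset.add_sum_erase _ _ (Finset.mem_univ s)]
      have h : ∑ t ∈ Finset.univ.erase s, α (Function.update (Function.update v s (x + y)) t
            (T (Function.update v s (x + y) t))) =
          ∑ t ∈ Finset.univ.erase s, α (Function.update (Function.update v s x) t
            (T (Function.update v s x t))) +
          ∑ t ∈ Finset.univ.erase s, α (Function.update (Function.update v s y) t
            (T (Function.update v s y t))) := by
        rw [← Finset.sum_add_distrib]
        refine Finset.sum_congr rfl fun t ht => ?_
        have hts := Finset.ne_of_mem_erase ht
        simp only [Function.update_of_ne hts, Function.update_comm hts.symm]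
        exact α.map_update_add _ _ _ _
      rw [h]
      simp only [AlternatingMap.map_update_add, map_add, Function.update_idem,
        Function.update_self]
      abel
    map_update_smul' := by
      intro inst v s c x
      obtain rfl : inst = instDecidableEqFin k := Subsingleton.elim _ _
      rw [← Finset.add_sum_erase _ _ (Finset.mem_univ s),
        ← Finset.add_sum_erase _ _ (Finset.mem_univ s)]
      have h : ∑ t ∈ Finset.univ.erase s, α (Function.update (Function.update v s (c • x)) t
            (T (Function.update v s (c • x) t))) =
          c • ∑ t ∈ Finset.univ.erase s, α (Function.update (Function.update v s x) t
            (T (Function.update v s x t))) := by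
        rw [Finset.smul_sum]
        refine Finset.sum_congr rfl fun t ht => ?_
        have hts := Finset.ne_of_mem_erase ht
        simp only [Function.update_of_ne hts, Function.update_comm hts.symm]
        exact α.map_update_smul _ _ _ _
      rw [h]
      simp only [AlternatingMap.map_update_smul, AlternatingMap.map_update_add, hT,
        Function.update_idem, Function.update_self, smul_eq_mul, Derivation.leibniz]
      ring
    map_eq_zero_of_eq' := by
      intro v i j hij hne
      have h : ∑ s, α (Function.update v s (T (v s))) = 0 := by
        rw [Fintype.sum_eq_add i j hne]
        · have hswap : Function.update v j (T (v j)) =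
              Function.update v i (T (v i)) ∘ Equiv.swap i j := by
            funext t
            by_cases hti : t = i
            · subst hti
              simp [Function.update_of_ne hne, Function.update_of_ne hne.symm, hij]
            · by_cases htj : t = j
              · subst htj
                simp [hij]
              · simp [Equiv.swap_apply_of_ne_of_ne hti htj, hti, htj]
          rw [hswap, α.map_swap _ hne, add_neg_cancel]
        · intro s hs
          refine α.map_eq_zero_of_eq _ (i := i) (j := j) ?_ hne
          rw [Function.update_of_ne hs.1.symm, Function.update_of_ne hs.2.symm, hij]
      rw [h, α.map_eq_zero_of_eq v hij hne, map_zero, sub_zero] }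

theorem deriveAlt_apply {M : Type*} [AddCommGroup M] [Module A M] {k : ℕ} (δ : Derivation K A A)
    (T : M →+ M) (hT : ∀ (a : A) (v : M), T (a • v) = a • T v + δ a • v)
    (α : M [⋀^Fin k]→ₗ[A] A) (v : Fin k → M) :
    deriveAlt δ T hT α v = δ (α v) - ∑ s, α (Function.update v s (T (v s))) := rfl

/-! #### Differential forms -/

/-- `∂/∂xᵢ` applied to each coefficient of a vector field. -/
def coeffPartial (D : Fin n → Derivation K A A) (i : Fin n) : (Fin n → A) →+ (Fin n → A) where
  toFun Y := fun j => D i (Y j)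
  map_zero' := by funext j; simp
  map_add' Y Z := by funext j; simp

/-- `∂α/∂xᵢ`: the form whose coefficients are the partial derivatives of those of `α`. -/
def partialForm (D : Fin n → Derivation K A A) {k : ℕ} (i : Fin n) :
    Form A n k →ₗ[K] Form A n k where
  toFun := deriveAlt (D i) (coeffPartial D i) (by
    intro a Y; funext j; simp [coeffPartial, mul_comm])
  map_add' α β := by
    ext v
    simp only [deriveAlt_apply, AlternatingMap.add_apply, map_add, Finset.sum_add_distrib]
    abel
  map_smul' c α := by
    ext v
    simp only [deriveAlt_apply, AlternatingMap.smul_apply, Derivation.map_smul, RingHom.id_apply,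
      smul_sub, Finset.smul_sum]

/-- The exterior derivative
`dα (v₀, …, v_k) = ∑ₛ (-1)ˢ (∑ᵢ (vₛ)ᵢ ∂α/∂xᵢ) (v₀, …, v̂ₛ, …, v_k)`. -/
def extD (D : Fin n → Derivation K A A) {k : ℕ} (α : Form A n k) : Form A n (k + 1) :=
  AlternatingMap.alternatizeUncurryFin
    (∑ i, (LinearMap.proj i : (Fin n → A) →ₗ[A] A).smulRight (partialForm D i α))

/-- `df ∧ α`, i.e. `(v₀, …, v_k) ↦ ∑ₛ (-1)ˢ df(vₛ) α (v₀, …, v̂ₛ, …, v_k)`. -/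
def dWedge (D : Fin n → Derivation K A A) {k : ℕ} (f : A) (α : Form A n k) : Form A n (k + 1) :=
  AlternatingMap.alternatizeUncurryFin
    ((∑ i, D i f • (LinearMap.proj i : (Fin n → A) →ₗ[A] A)).smulRight α)

theorem extD_apply (D : Fin n → Derivation K A A) {k : ℕ} (α : Form A n k)
    (v : Fin (k + 1) → Fin n → A) :
    extD D α v = ∑ s : Fin (k + 1), (-1) ^ (s : ℕ) • ∑ i, v s i • partialForm D i α (s.removeNth v) := by
  have h : ∀ (t : Finset (Fin n)) (β : Fin n → Form A n k) (c : Fin n → A) (u : Fin k → Fin n → A),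
      (∑ i ∈ t, c i • β i) u = ∑ i ∈ t, c i * β i u := by
    intro t β c u
    induction t using Finset.induction_on with
    | empty => simp
    | insert a t ha ih => rw [Finset.sum_insert ha, Finset.sum_insert ha, ← ih]; simp
  simp [extD, AlternatingMap.alternatizeUncurryFin_apply, h]

theorem dWedge_apply (D : Fin n → Derivation K A A) {k : ℕ} (f : A) (α : Form A n k)
    (v : Fin (k + 1) → Fin n → A) :
    dWedge D f α v =
      ∑ s : Fin (k + 1), (-1) ^ (s : ℕ) • ((∑ i, D i f * v s i) * α (s.removeNth v)) := by
  simp [dWedge, AlternatingMap.alternatizeUncurryFin_apply]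

/-- The operator `d_f^{(p)} : Ω^k → Ω^{k+1}`, `α ↦ f dα - (k - p) df ∧ α`. -/
def dfp (D : Fin n → Derivation K A A) (f : A) (p : ℤ) (k : ℕ) :
    Form A n k →ₗ[K] Form A n (k + 1) where
  toFun α := f • extD D α - ((k : ℤ) - p) • dWedge D f α
  map_add' α β := by
    ext v
    simp only [AlternatingMap.sub_apply, AlternatingMap.add_apply, AlternatingMap.smul_apply,
      extD_apply, dWedge_apply, map_add, smul_add, mul_add, Finset.sum_add_distrib]
    abel
  map_smul' c α := by
    ext v
    simp only [AlternatingMap.sub_apply, AlternatingMap.smul_apply,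
      extD_apply, dWedge_apply, map_smul, RingHom.id_apply, smul_sub, mul_smul_comm]
    simp only [smul_comm _ c, ← Finset.smul_sum]

/-- The coboundaries `B^k_{f,p} = d_f^{(p)} (Ω^{k-1})`. -/
def coboundaries (D : Fin n → Derivation K A A) (f : A) (p : ℤ) :
    (k : ℕ) → Submodule K (Form A n k)
  | 0 => ⊥
  | k + 1 => LinearMap.range (dfp D f p k)

/-! #### Multivectors -/

/-- The Lie derivative of a 1-form: `(L_X θ)ⱼ = X.θⱼ + ∑ᵢ θᵢ ∂Xᵢ/∂xⱼ`. -/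
def lieOneForm (D : Fin n → Derivation K A A) (X : Fin n → A) : (Fin n → A) →+ (Fin n → A) where
  toFun θ := fun j => vf D X (θ j) + ∑ i, θ i * D j (X i)
  map_zero' := by funext j; simp
  map_add' θ η := by
    funext j
    simp only [Pi.add_apply, map_add, add_mul, Finset.sum_add_distrib]
    abel

theorem lieOneForm_apply (D : Fin n → Derivation K A A) (X θ : Fin n → A) (j : Fin n) :
    lieOneForm D X θ j = vf D X (θ j) + ∑ i, θ i * D j (X i) := rfl

/-- The Schouten bracket `[X, P] = L_X P` of a vector field and a `k`-vector:
`[X, P](θ₁, …, θ_k) = X.(P(θ₁, …, θ_k)) - ∑ₛ P(θ₁, …, L_X θₛ, …, θ_k)`. -/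
def schouten (D : Fin n → Derivation K A A) {k : ℕ} (X : Fin n → A) (P : MultiVector A n k) :
    MultiVector A n k :=
  deriveAlt (vf D X) (lieOneForm D X) (by
    intro a θ
    funext j
    simp only [lieOneForm_apply, Pi.smul_apply, Pi.add_apply, smul_eq_mul, Derivation.leibniz,
      mul_add, Finset.mul_sum, mul_assoc]
    ring) P

/-- The last operator `X ↦ [X, Λ]` of the complex
`0 → 𝓕^{n-1} → 𝓧¹ → 𝓧ⁿ → 0` attached to an `n`-vector `Λ`. -/
def bracketWith (D : Fin n → Derivation K A A) (Λ : MultiVector A n n) :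
    (Fin n → A) →ₗ[K] MultiVector A n n where
  toFun X := schouten D X Λ
  map_add' X Y := by
    have h : ∀ θ, lieOneForm D (X + Y) θ = lieOneForm D X θ + lieOneForm D Y θ := by
      intro θ
      funext j
      simp only [lieOneForm_apply, vf_apply, Pi.add_apply, map_add, add_mul, mul_add,
        Finset.sum_add_distrib]
      abel
    ext v
    simp only [schouten, deriveAlt_apply, AlternatingMap.add_apply, h,
      AlternatingMap.map_update_add, Finset.sum_add_distrib, vf_apply, Pi.add_apply, add_mul]
    abel
  map_smul' c X := by
    have hX : c • X = algebraMap K A c • X := by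
      funext i
      simp [Algebra.smul_def]
    have h : ∀ θ, lieOneForm D (c • X) θ = algebraMap K A c • lieOneForm D X θ := by
      intro θ
      funext j
      simp only [lieOneForm_apply, vf_apply, Pi.smul_apply, smul_eq_mul, hX, Derivation.leibniz,
        Derivation.map_algebraMap, mul_add, Finset.mul_sum]
      congr 1 <;> refine Finset.sum_congr rfl fun i _ => by ring
    ext v
    simp only [schouten, deriveAlt_apply, AlternatingMap.smul_apply, h,
      AlternatingMap.map_update_smul, vf_apply, RingHom.id_apply]
    simp only [Pi.smul_apply, Algebra.smul_def c, smul_eq_mul, mul_sub, Finset.mul_sum,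
      mul_assoc]

/-- `H²_Λ`: the quotient of the space of `n`-vectors by the subspace of all `[X, Λ]`. -/
abbrev H2 (D : Fin n → Derivation K A A) (Λ : MultiVector A n n) :=
  MultiVector A n n ⧸ LinearMap.range (bracketWith D Λ)

/-- The class of an `n`-vector in `H²_Λ`. -/
def H2.mk (D : Fin n → Derivation K A A) (Λ : MultiVector A n n) :
    MultiVector A n n →ₗ[K] H2 D Λ :=
  Submodule.mkQ _

/-- The algebra `Q_f`: the quotient by the ideal generated by the partial derivatives of `f`. -/
abbrev Milnor (D : Fin n → Derivation K A A) (f : A) :=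
  A ⧸ Ideal.span (Set.range fun i => D i f)

/-! #### Infinitesimal deformations

Over the dual numbers `A[ε]`, `ε² = 0`, with the partial derivatives extended `ε`-linearly. -/

/-- The `ε`-linear extension of a derivation to the dual numbers. -/
def dualDerivation (δ : Derivation K A A) : Derivation K (DualNumber A) (DualNumber A) :=
  Derivation.mk'
    { toFun := fun a => (TrivSqZeroExt.inl (δ a.fst) + TrivSqZeroExt.inr (δ a.snd) : DualNumber A)
      map_add' := by
        intro a b
        ext <;> simp
      map_smul' := by
        intro c a
        ext <;> simp }
    (by
      intro a b
      ext
      · simp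
      · simp
        ring)

/-- The restriction of an `n`-vector over the dual numbers to 1-forms over `A`, followed by an
`A`-linear map `π : A[ε] → A`. -/
def dualPart (π : DualNumber A →ₗ[A] A) (P : MultiVector (DualNumber A) n n) :
    MultiVector A n n where
  toFun θ := π (P fun s i => TrivSqZeroExt.inl (θ s i))
  map_update_add' := by
    intro inst θ s x y
    have h : ∀ z : Fin n → A, (fun t i => (TrivSqZeroExt.inl (Function.update θ s z t i) :
        DualNumber A)) = Function.update (fun t i => TrivSqZeroExt.inl (θ t i)) s
          (fun i => TrivSqZeroExt.inl (z i)) := by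
      intro z
      funext t
      by_cases ht : t = s
      · subst ht; simp
      · simp [Function.update_of_ne ht]
    rw [h, h, h, ← map_add, ← P.map_update_add]
    congr 3
    funext i
    simp
  map_update_smul' := by
    intro inst θ s c x
    have h : ∀ z : Fin n → A, (fun t i => (TrivSqZeroExt.inl (Function.update θ s z t i) :
        DualNumber A)) = Function.update (fun t i => TrivSqZeroExt.inl (θ t i)) s
          (fun i => TrivSqZeroExt.inl (z i)) := by
      intro z
      funext t
      by_cases ht : t = s
      · subst ht; simp
      · simp [Function.update_of_ne ht]
    have h' : (fun i => (TrivSqZeroExt.inl ((c • x) i) : DualNumber A)) =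
        (TrivSqZeroExt.inl c : DualNumber A) • fun i => TrivSqZeroExt.inl (x i) := by
      funext i
      simp
    rw [h, h, h', P.map_update_smul, ← π.map_smul]
    congr 1
    ext <;> simp
  map_eq_zero_of_eq' := by
    intro θ i j hij hne
    rw [P.map_eq_zero_of_eq _ _ hne, map_zero]
    simp only [hij]

/-- The `ε⁰`-part `Λ` of an `n`-vector `Λ + εΠ` over the dual numbers. -/
def constPart (P : MultiVector (DualNumber A) n n) : MultiVector A n n :=
  dualPart (TrivSqZeroExt.fstHom A A A).toLinearMap P

/-- The `ε¹`-part `Π` of an `n`-vector `Λ + εΠ` over the dual numbers. -/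
def epsPart (P : MultiVector (DualNumber A) n n) : MultiVector A n n :=
  dualPart (TrivSqZeroExt.sndHom A A) P

/-- An infinitesimal (first-order) deformation of `Λ`: an `n`-vector over the dual numbers which
reduces to `Λ` modulo `ε`. -/
def InfDeformation (Λ : MultiVector A n n) :=
  {P : MultiVector (DualNumber A) n n // constPart P = Λ}

/-- The bracket `{g₁, …, gₙ} = P(dg₁, …, dgₙ)` of functions defined by an `n`-vector. -/
def nambuBracket (D : Fin n → Derivation K A A) (P : MultiVector A n n) (g : Fin n → A) : A :=
  P fun s i => D i (g s)

/-- The infinitesimal change of coordinates `id + εX` acting on functions. -/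
def infFlow (D : Fin n → Derivation K A A) (X : Fin n → A) (a : DualNumber A) : DualNumber A :=
  a + TrivSqZeroExt.inr (vf D X a.fst)

/-- Two infinitesimal deformations are equivalent if some infinitesimal change of coordinates
`id + εX` carries the bracket of the first to the bracket of the second. -/
def InfDeformation.Equivalent (D : Fin n → Derivation K A A) {Λ : MultiVector A n n}
    (P P' : InfDeformation Λ) : Prop :=
  ∃ X : Fin n → A, ∀ g : Fin n → DualNumber A,
    infFlow D X (nambuBracket (fun i => dualDerivation (D i)) P.1 g) =
      nambuBracket (fun i => dualDerivation (D i)) P'.1 fun s => infFlow D X (g s)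

end Calculus

/-! ### Quasihomogeneous polynomials and monomial bases -/

section Polynomials

variable {𝕜 : Type*} [RCLike 𝕜] {n : ℕ}

variable (𝕜) in
/-- Polynomials which are quasihomogeneous of degree `d ∈ ℤ` for the weights `w₁, …, wₙ`
(only `0` if no monomial has that degree). -/
abbrev quasihom (w : Fin n → ℕ) (d : ℤ) : Submodule 𝕜 (MvPolynomial (Fin n) 𝕜) :=
  MvPolynomial.weightedHomogeneousSubmodule 𝕜 (fun i => (w i : ℤ)) d

/-- A set `B` of (exponents of) monomials is a monomial basis of `Q_f` if the classes of these
monomials form a basis of the vector space `Q_f`. -/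
def IsMonomialBasis (r : Kind) (f : MvPolynomial (Fin n) 𝕜) (B : Set (Fin n →₀ ℕ)) : Prop :=
  let cls : B → Milnor (pd r 𝕜 n) (poly r f) := fun e =>
    Ideal.Quotient.mk _ (poly r (MvPolynomial.monomial e.1 1))
  LinearIndependent 𝕜 cls ∧ Submodule.span 𝕜 (Set.range cls) = ⊤

/-- The linear combinations of the monomials in `B`. -/
def monomialSpan (𝕜 : Type*) [RCLike 𝕜] {n : ℕ} (B : Set (Fin n →₀ ℕ)) :
    Submodule 𝕜 (MvPolynomial (Fin n) 𝕜) :=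
  Submodule.span 𝕜 ((fun e => MvPolynomial.monomial e 1) '' B)

/-- The `n`-vector `Λ = f ∂/∂x₁ ∧ … ∧ ∂/∂xₙ`. -/
def Lam (r : Kind) (f : MvPolynomial (Fin n) 𝕜) : MultiVector (Fn r 𝕜 n) n n :=
  poly r f • unitMultiVector (Fn r 𝕜 n) n

end Polynomials

end NambuGerm

end

namespace NambuGerm

/-! In top degree a form or a multivector is one coefficient in the function algebra `A`.
Contracting `ω` with a vector field accounts for all the (n-1)-forms that matter, and both
`B^n_{f,n-2}` and `{[X, Λ]}` become the range of `T X = f div X - X.f` (`mem_coboundaries_iff`,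
`map_range_bracketWith`). Claims 1 and 2 then concern `A / range T`. With `d = N - ∑ wᵢ` and `V_d`
the quasihomogeneous polynomials of degree `d`, they express exactness of `0 → V_d → A / range T →
Q_f → 0`, the first map being `h ↦ f h`.

Let `E = ∑ wᵢ xᵢ ∂ᵢ`. Since `E f = N f` and `N ≠ 0`, the germ `f`, and with it `range T`, lies in
the Jacobian ideal; so the second map exists and kills `f h`. If `φ = Y.f`, write `div Y = E g - d g
+ P` with `P ∈ V_d`. A direct computation gives `T (g E - Y) = φ - f P`, so the kernel is no larger
(`exists_sub_mem_range_of_mem_jacobianIdeal`).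

Injectivity is where `n ≥ 3` enters. Truncating at high order and taking weighted components reduces
`f h = T X` to a polynomial identity `f h = T P` with `P i` of degree `d + wᵢ`. For `g = div P - h`
it says `P.f = f g`, so `P - (g / N) E` is a syzygy of the partial derivatives of `f`. Finite
codimension puts a power of each variable in the polynomial Jacobian ideal, the Koszul complex of
the partials is therefore exact, and the `i`-th coefficient of a syzygy lies in the ideal of the `∂ⱼ
f`, `j ≠ i`. Its degree is too small for that unless it vanishes. Thus `P = (g / N) E`, whose
divergence is `g`, and `h = 0` (`eq_zero_of_mul_eq_twistedDiv`).

The three kinds of function enter only through `IsLocalCalculus`: Hadamard's lemma and solvability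
of `E h + (a + 1) h = φ`. For germs both come from the averages `∫₀¹ t^a φ(t^w x) dt`; for formal
series they are coefficientwise divisions.

Claim 3 is a first-order expansion over the dual numbers: `id + εX` carries `Λ + εΠ` to `Λ + εΠ'`
exactly when `[X, Λ] = Π' - Π` (`equivalent_iff`). -/

/-- The standard basis of vector fields. -/
def stdFrame (R : Type*) [CommRing R] (n : ℕ) : Fin n → Fin n → R := fun i => Pi.single i 1

/-! ### Exterior algebra and exactness of the Koszul complex -/

section Koszul

variable {R : Type*} [CommRing R] {n : ℕ}

/-- The wedge product `θ ∧ α` of a covector with an alternating form. -/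
noncomputable def covWedge (θ : (Fin n → R) →ₗ[R] R) {k : ℕ} : Form R n k →ₗ[R] Form R n (k + 1) :=
  AlternatingMap.alternatizeUncurryFinLM ∘ₗ LinearMap.smulRightₗ θ

theorem covWedge_apply (θ : (Fin n → R) →ₗ[R] R) {k : ℕ} (α : Form R n k)
    (v : Fin (k + 1) → Fin n → R) :
    covWedge θ α v = ∑ s : Fin (k + 1), (-1) ^ (s : ℕ) • (θ (v s) * α (s.removeNth v)) := by
  simp [covWedge, AlternatingMap.alternatizeUncurryFin_apply]

/-- The double wedge antisymmetrizes `θ ⊗ θ ⊗ α`, which is symmetric in its first two slots. -/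
theorem covWedge_covWedge (θ : (Fin n → R) →ₗ[R] R) {k : ℕ} (α : Form R n k) :
    covWedge θ (covWedge θ α) = 0 := by
  have h : LinearMap.smulRightₗ θ (covWedge θ α) = AlternatingMap.alternatizeUncurryFinLM ∘ₗ
      (LinearMap.smulRightₗ θ (LinearMap.smulRightₗ θ α)) := by
    ext x
    simp [covWedge]
  change AlternatingMap.alternatizeUncurryFin (LinearMap.smulRightₗ θ (covWedge θ α)) = 0
  rw [h]
  refine AlternatingMap.alternatizeUncurryFin_alternatizeUncurryFinLM_comp_of_symmetric ?_
  intro x y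
  simp only [LinearMap.smulRightₗ_apply, LinearMap.smulRight_apply, LinearMap.smul_apply]
  rw [smul_comm]

/-- Contraction of an alternating form with a vector. -/
noncomputable def contract (a : Fin n → R) {k : ℕ} : Form R n (k + 1) →ₗ[R] Form R n k :=
  (LinearMap.applyₗ a) ∘ₗ AlternatingMap.curryLeftLinearMap

theorem contract_apply (a : Fin n → R) {k : ℕ} (α : Form R n (k + 1)) (v : Fin k → Fin n → R) :
    contract a α v = α (Matrix.vecCons a v) := rfl

/-- Contraction is an antiderivation; hence it is a homotopy on the Koszul complex between
multiplication by `θ a` and zero. -/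
theorem contract_covWedge (θ : (Fin n → R) →ₗ[R] R) (a : Fin n → R) {k : ℕ}
    (α : Form R n (k + 1)) :
    contract a (covWedge θ α) = θ a • α - covWedge θ (contract a α) := by
  ext v
  simp only [contract_apply, covWedge_apply, AlternatingMap.sub_apply, AlternatingMap.smul_apply]
  rw [Fin.sum_univ_succ, sub_eq_add_neg, ← Finset.sum_neg_distrib]
  congr 1
  · simp [Matrix.vecCons]
  · refine Finset.sum_congr rfl fun s _ => ?_
    have h : s.succ.removeNth (Matrix.vecCons a v) = Matrix.vecCons a (s.removeNth v) := by
      funext t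
      refine Fin.cases ?_ (fun t => ?_) t
      · simp [Fin.removeNth, Matrix.vecCons]
      · simp [Fin.removeNth, Matrix.vecCons]
    rw [h]
    simp [pow_succ, Matrix.vecCons]

theorem contract_covWedge_zero (θ : (Fin n → R) →ₗ[R] R) (a : Fin n → R) (α : Form R n 0) :
    contract a (covWedge θ α) = θ a • α := by
  ext v
  simp only [contract_apply, covWedge_apply, AlternatingMap.smul_apply]
  simp [Matrix.vecCons, Subsingleton.elim _ v]

/-- `∑ dxᵢ ∧ ι_{eᵢ}` multiplies a form by its degree. This permits induction on the degree of a form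
without choosing a basis of forms. -/
theorem smul_eq_sum_covWedge_contract {k : ℕ} (α : Form R n (k + 1)) :
    (k + 1) • α = ∑ i : Fin n, covWedge (LinearMap.proj i : (Fin n → R) →ₗ[R] R) (contract (stdFrame R n i) α) := by
  rw [← AlternatingMap.alternatizeUncurryFin_curryLeft]
  have h : α.curryLeft = ∑ i : Fin n, LinearMap.smulRightₗ
      (LinearMap.proj i : (Fin n → R) →ₗ[R] R) (contract (stdFrame R n i) α) := by
    ext i v
    simp [Pi.single_apply]
    rfl
  rw [h]
  change AlternatingMap.alternatizeUncurryFinLM _ = _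
  rw [map_sum]
  rfl

theorem map_mem_ideal_smul_top {M M' : Type*} [AddCommGroup M] [Module R M] [AddCommGroup M']
    [Module R M'] (I : Ideal R) (φ : M →ₗ[R] M') {x : M} (hx : x ∈ I • (⊤ : Submodule R M)) :
    φ x ∈ I • (⊤ : Submodule R M') := by
  have h₂ := Submodule.mem_map_of_mem (f := φ) hx
  rw [Submodule.map_smul''] at h₂
  exact Submodule.smul_mono le_rfl le_top h₂

/-- For the converse, contractions lower the degree and the preceding identity rebuilds `(k + 1) α`
from them; the rational scalars are there to divide by `k + 1`. -/
theorem mem_ideal_smul_top_iff [Algebra ℚ R] (I : Ideal R) {k : ℕ} (α : Form R n k) :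
    α ∈ I • (⊤ : Submodule R (Form R n k)) ↔ ∀ v, α v ∈ I := by
  constructor
  · intro h v
    refine Submodule.smul_induction_on h ?_ ?_
    · intro r hr β _
      exact I.mul_mem_right _ hr
    · intro β γ hβ hγ
      exact I.add_mem hβ hγ
  · induction k with
    | zero =>
      intro h
      have : α = α 0 • AlternatingMap.constOfIsEmpty R (Fin n → R) (Fin 0) (1 : R) := by
        ext v
        simp [Subsingleton.elim v 0]
      rw [this]
      exact Submodule.smul_mem_smul (h 0) trivial
    | succ k ih =>
      intro h
      have hmem : (k + 1) • α ∈ I • (⊤ : Submodule R (Form R n (k + 1))) := by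
        rw [smul_eq_sum_covWedge_contract]
        refine Submodule.sum_mem _ fun i _ => ?_
        exact map_mem_ideal_smul_top I _ (ih (contract (stdFrame R n i) α) fun v => h _)
      have : α = algebraMap ℚ R ((k + 1 : ℕ) : ℚ)⁻¹ • ((k + 1) • α) := by
        rw [← Nat.cast_smul_eq_nsmul R, smul_smul, ← map_natCast (algebraMap ℚ R) (k + 1),
          ← map_mul, inv_mul_cancel₀ (by exact_mod_cast k.succ_ne_zero), map_one, one_smul]
      rw [this]
      exact Submodule.smul_mem _ _ hmem

/-- The forms divisible by `θ` (only `0` in degree `0`). -/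
noncomputable def covBoundaries (θ : (Fin n → R) →ₗ[R] R) : (k : ℕ) → Submodule R (Form R n k)
  | 0 => ⊥
  | k + 1 => LinearMap.range (covWedge θ (k := k))

theorem covWedge_of_mem_covBoundaries (θ : (Fin n → R) →ₗ[R] R) {k : ℕ} {α : Form R n k}
    (h : α ∈ covBoundaries θ k) : covWedge θ α = 0 := by
  cases k with
  | zero =>
    rw [(Submodule.mem_bot R).1 h, map_zero]
  | succ k =>
    obtain ⟨β, rfl⟩ := h
    exact covWedge_covWedge θ β

/-- Exactness of the Koszul complex of `θ` modulo the partial ideals `I j` of a sequence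
`b 0, …, b (n - 1)` of values of `θ` which is regular, in degrees `k` with `k + j < n`. -/
theorem koszul_exact [Algebra ℚ R] (θ : (Fin n → R) →ₗ[R] R) (I : ℕ → Ideal R) (m : ℕ)
    (b : ℕ → R) (hb : ∀ j < m, ∃ a, θ a = b j)
    (hI : ∀ j < m, I (j + 1) = I j ⊔ Ideal.span {b j})
    (hreg : ∀ j < m, ∀ p, b j * p ∈ I j → p ∈ I j) (k : ℕ) :
    ∀ j, k + j < m → ∀ α : Form R n k, covWedge θ α ∈ I j • (⊤ : Submodule R (Form R n (k + 1))) →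
      α ∈ covBoundaries θ k ⊔ I j • (⊤ : Submodule R (Form R n k)) := by
  have cancel : ∀ (k j : ℕ), j < m → ∀ α : Form R n k,
      b j • α ∈ I j • (⊤ : Submodule R (Form R n k)) → α ∈ I j • (⊤ : Submodule R (Form R n k)) := by
    intro k j hj α h
    rw [mem_ideal_smul_top_iff] at h ⊢
    exact fun v => hreg j hj _ (h v)
  induction k with
  | zero =>
    intro j hj α hα
    obtain ⟨a, ha⟩ := hb j (by omega)
    refine Submodule.mem_sup_right (cancel 0 j (by omega) α ?_)
    rw [← ha, ← contract_covWedge_zero]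
    exact map_mem_ideal_smul_top _ _ hα
  | succ k ih =>
    intro j hj α hα
    obtain ⟨a, ha⟩ := hb j (by omega)
    -- Contracting with a vector `a` where `θ a = b j` shows that `b j α` and `θ ∧ ι_a α` agree
    -- modulo `I j`.
    have h₁ : b j • α - covWedge θ (contract a α) ∈ I j • (⊤ : Submodule R (Form R n (k + 1))) := by
      rw [← ha, ← contract_covWedge]
      exact map_mem_ideal_smul_top _ _ hα
    have hsup : ∀ l, I (j + 1) • (⊤ : Submodule R (Form R n l)) =
        I j • (⊤ : Submodule R (Form R n l)) ⊔ Ideal.span {b j} • (⊤ : Submodule R (Form R n l)) := by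
      intro l
      rw [hI j (by omega), Submodule.sup_smul]
    -- Modulo `I (j + 1)` the term `b j α` also disappears, so `ι_a α` falls under the induction
    -- hypothesis: one degree less is paid for by one more element of the sequence, keeping `k + j`
    -- fixed.
    have h₂ : covWedge θ (contract a α) ∈ I (j + 1) • (⊤ : Submodule R (Form R n (k + 1))) := by
      rw [hsup, ← sub_sub_cancel (b j • α) (covWedge θ (contract a α))]
      exact sub_mem (Submodule.mem_sup_right (Submodule.smul_mem_smul
        (Ideal.mem_span_singleton_self _) trivial)) (Submodule.mem_sup_left h₁)
    have h₃ := ih (j + 1) (by omega) _ h₂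
    rw [hsup, Submodule.mem_sup] at h₃
    obtain ⟨u, hu, y, hy, huy⟩ := h₃
    rw [Submodule.mem_sup] at hy
    obtain ⟨y, hy, y', hy', rfl⟩ := hy
    rw [Submodule.ideal_span_singleton_smul, Submodule.mem_smul_pointwise_iff_exists] at hy'
    obtain ⟨v, -, rfl⟩ := hy'
    rw [← huy, map_add, map_add, map_smul, covWedge_of_mem_covBoundaries θ hu, zero_add] at h₁
    -- Now `ι_a α` is a boundary plus an element of `I j` plus `b j v`. Wedging with `θ` kills the
    -- boundary and leaves a multiple of `b j`, which regularity cancels.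
    have h₄ : b j • (α - covWedge θ v) ∈ I j • (⊤ : Submodule R (Form R n (k + 1))) := by
      have := add_mem h₁ (map_mem_ideal_smul_top (I j) (covWedge θ) hy)
      convert this using 1
      rw [smul_sub]
      abel
    rw [← add_sub_cancel (covWedge θ v) α]
    exact add_mem (Submodule.mem_sup_left ⟨v, rfl⟩)
      (Submodule.mem_sup_right (cancel _ _ (by omega) _ h₄))

end Koszul

/-! ### Forms of top degree on the standard frame -/

section TopForms

variable {R : Type*} [CommRing R]

theorem basisFun_eq_stdFrame (R : Type*) [CommRing R] (n : ℕ) :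
    (⇑(Pi.basisFun R (Fin n)) : Fin n → Fin n → R) = stdFrame R n := by
  funext i
  simp [stdFrame]

theorem form_ext_stdFrame {n : ℕ} {α β : Form R n n}
    (h : α (stdFrame R n) = β (stdFrame R n)) : α = β := by
  rw [α.eq_smul_basis_det (Pi.basisFun R (Fin n)), β.eq_smul_basis_det (Pi.basisFun R (Fin n)),
    basisFun_eq_stdFrame, h]

theorem det_stdFrame (n : ℕ) : (Pi.basisFun R (Fin n)).det (stdFrame R n) = 1 := by
  rw [← basisFun_eq_stdFrame]
  exact Module.Basis.det_self _

theorem form_update_stdFrame {n : ℕ} (α : Form R n n) (s : Fin n) (X : Fin n → R) :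
    α (Function.update (stdFrame R n) s X) = X s * α (stdFrame R n) := by
  have hX : X = ∑ i, X i • stdFrame R n i := by
    funext j
    simp [stdFrame, Finset.sum_apply, Pi.single_apply]
  conv_lhs => rw [hX]
  rw [AlternatingMap.map_update_sum, Finset.sum_eq_single s]
  · rw [AlternatingMap.map_update_smul, Function.update_eq_self, smul_eq_mul]
  · intro j _ hj
    rw [AlternatingMap.map_update_smul, α.map_eq_zero_of_eq _ (i := j) (j := s) _ hj, smul_zero]
    rw [Function.update_of_ne hj, Function.update_self]
  · simp

/-- The coefficients of `ι_X α` are, up to sign, those of `X` times that of `α`: this is how vector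
fields are read as (n-1)-forms. -/
theorem contract_removeNth_stdFrame {m : ℕ} (α : Form R (m + 1) (m + 1)) (X : Fin (m + 1) → R)
    (s : Fin (m + 1)) :
    contract X α (s.removeNth (stdFrame R (m + 1))) =
      (-1) ^ (s : ℕ) * (X s * α (stdFrame R (m + 1))) := by
  rw [contract_apply, ← AlternatingMap.neg_one_pow_smul_map_insertNth α s,
    ← form_update_stdFrame α s X, ← Fin.insertNth_removeNth]
  simp

end TopForms

/-! ### Syzygies from Koszul exactness -/

section Syzygies

variable {R : Type*} [CommRing R] [Algebra ℚ R]

/-- Encode `Y` as the (n-1)-form `α = ι_Y vol`. The relation says `θ ∧ α = 0`, so `α = θ ∧ β`, or `α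
= 0` when `n = 1`. Evaluating `θ ∧ β` on the frame with `eᵢ` removed involves only the values `θⱼ`
with `j ≠ i`. -/
theorem syzygy_mem_span {n : ℕ} (θ : Fin n → R) (I : ℕ → Ideal R) (hI0 : I 0 = ⊥)
    (b : ℕ → R) (hb : ∀ j < n, b j ∈ Ideal.span (Set.range θ))
    (hI : ∀ j < n, I (j + 1) = I j ⊔ Ideal.span {b j})
    (hreg : ∀ j < n, ∀ p, b j * p ∈ I j → p ∈ I j)
    (Y : Fin n → R) (hY : ∑ i, Y i * θ i = 0) (i : Fin n) :
    Y i ∈ Ideal.span (θ '' {j | j ≠ i}) := by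
  obtain ⟨m, rfl⟩ : ∃ m, n = m + 1 := ⟨n - 1, by have := i.pos; omega⟩
  set Θ : (Fin (m + 1) → R) →ₗ[R] R := Fintype.linearCombination R θ with hΘ
  have hΘs : ∀ j, Θ (stdFrame R (m + 1) j) = θ j := by
    intro j
    simp [hΘ, Fintype.linearCombination_apply, stdFrame, Pi.single_apply]
  set α := contract Y (Pi.basisFun R (Fin (m + 1))).det with hα
  have hα' : ∀ s : Fin (m + 1), α (s.removeNth (stdFrame R (m + 1))) = (-1) ^ (s : ℕ) * Y s := by
    intro s
    rw [hα, contract_removeNth_stdFrame, det_stdFrame, mul_one]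
  have hαc : covWedge Θ α = 0 := by
    refine form_ext_stdFrame ?_
    rw [covWedge_apply, AlternatingMap.zero_apply, ← hY]
    refine Finset.sum_congr rfl fun s _ => ?_
    rw [hα', hΘs]
    have hsq : (-1 : R) ^ (s : ℕ) * (-1) ^ (s : ℕ) = 1 := by
      rw [← mul_pow]
      simp
    simp only [zsmul_eq_mul, Int.cast_pow, Int.cast_neg, Int.cast_one]
    linear_combination (θ s * Y s) * hsq
  have h := koszul_exact Θ I (m + 1) b (fun j hj => by
      have := hb j hj
      rw [Ideal.span, ← Fintype.range_linearCombination R] at this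
      exact this) hI hreg m 0 (by omega) α (by rw [hαc]; exact zero_mem _)
  rw [hI0, Submodule.bot_smul, sup_bot_eq] at h
  have key : α (i.removeNth (stdFrame R (m + 1))) ∈ Ideal.span (θ '' {j | j ≠ i}) := by
    cases m with
    | zero =>
      rw [(Submodule.mem_bot R).1 h]
      exact zero_mem _
    | succ m =>
      obtain ⟨β, hβ⟩ := h
      rw [← hβ, covWedge_apply]
      refine sum_mem fun t _ => ?_
      refine zsmul_mem (Ideal.mul_mem_right _ _ (Ideal.subset_span ?_)) _
      exact ⟨i.succAbove t, Fin.succAbove_ne i t, by rw [← hΘs]; rfl⟩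
  have : Y i = (-1) ^ (i : ℕ) * α (i.removeNth (stdFrame R (m + 1))) := by
    rw [hα', ← mul_assoc, ← mul_pow]
    simp
  rw [this]
  exact Ideal.mul_mem_left _ _ key

end Syzygies

/-! ### Powers of the variables as a regular sequence -/

section PolynomialSyzygies

variable {K : Type*} [Field K] {n : ℕ}

open MvPolynomial in
-- Membership in a monomial ideal is tested on exponents, and multiplying by a power of `X j` does
-- not change the exponents of the variables indexed by `T`.
theorem mem_span_of_X_pow_mul_mem (e : Fin n → ℕ) (T : Set (Fin n)) (j : Fin n) (hj : j ∉ T)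
    (p : MvPolynomial (Fin n) K)
    (hp : X j ^ e j * p ∈ Ideal.span ((fun s => monomial s (1 : K)) ''
      ((fun i : Fin n => Finsupp.single i (e i)) '' T))) :
    p ∈ Ideal.span ((fun s => monomial s (1 : K)) ''
      ((fun i : Fin n => Finsupp.single i (e i)) '' T)) := by
  rw [mem_ideal_span_monomial_image] at hp ⊢
  intro m hm
  have hm' : Finsupp.single j (e j) + m ∈ (X j ^ e j * p).support := by
    rw [mem_support_iff, X_pow_eq_monomial, coeff_monomial_mul, one_mul]
    exact mem_support_iff.1 hm
  obtain ⟨_, ⟨l, hl, rfl⟩, hle⟩ := hp _ hm'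
  refine ⟨_, ⟨l, hl, rfl⟩, ?_⟩
  have hle' : e l ≤ (Finsupp.single j (e j) + m) l := by simpa using hle l
  have hne : l ≠ j := fun h => hj (h ▸ hl)
  rw [Finsupp.add_apply, Finsupp.single_eq_of_ne hne, zero_add] at hle'
  exact Finsupp.single_le_iff.2 hle'

open MvPolynomial in
/-- If `θ₁, …, θₙ` generate an ideal of `K[x₁, …, xₙ]` containing a power of each variable, then
in each relation `∑ Yᵢ θᵢ = 0` the coefficient `Yᵢ` lies in the ideal of the `θⱼ`, `j ≠ i`. -/
theorem mvPolynomial_syzygy_mem_span [CharZero K] (θ : Fin n → MvPolynomial (Fin n) K)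
    (e : Fin n → ℕ) (he : ∀ i, X i ^ e i ∈ Ideal.span (Set.range θ))
    (Y : Fin n → MvPolynomial (Fin n) K) (hY : ∑ i, Y i * θ i = 0) (i : Fin n) :
    Y i ∈ Ideal.span (θ '' {j | j ≠ i}) := by
  let b : ℕ → MvPolynomial (Fin n) K := fun j => if h : j < n then X ⟨j, h⟩ ^ e ⟨j, h⟩ else 0
  let S : ℕ → Set (Fin n →₀ ℕ) := fun j => (fun i : Fin n => Finsupp.single i (e i)) '' {i | (i : ℕ) < j}
  refine syzygy_mem_span θ (fun j => Ideal.span ((fun s => monomial s (1 : K)) '' S j)) ?_ b ?_ ?_ ?_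
    Y hY i
  · simp [S]
  · intro j hj
    simp only [b, hj, dif_pos]
    exact he _
  · intro j hj
    simp only [b, hj, dif_pos]
    rw [← Ideal.span_union]
    congr 1
    have : {i : Fin n | (i : ℕ) < j + 1} = {i : Fin n | (i : ℕ) < j} ∪ {⟨j, hj⟩} := by
      ext i
      simp only [Set.mem_ofPred_eq, Set.mem_union, Set.mem_singleton_iff, Fin.ext_iff]
      omega
    simp only [S, this, Set.image_union, Set.image_singleton]
    rw [X_pow_eq_monomial]
  · intro j hj p hp
    simp only [b, hj, dif_pos] at hp
    exact mem_span_of_X_pow_mul_mem e _ _ (lt_irrefl j) p hp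

end PolynomialSyzygies

/-! ### Weighted homogeneous polynomials -/

section WeightedPolynomials

open MvPolynomial

variable {K : Type*} [Field K] {n : ℕ} {w : Fin n → ℕ}

/-- Weighted homogeneous polynomials of degree `d ∈ ℤ`. -/
noncomputable abbrev whom (K : Type*) [Field K] {n : ℕ} (w : Fin n → ℕ) (d : ℤ) :
    Submodule K (MvPolynomial (Fin n) K) :=
  weightedHomogeneousSubmodule K (fun i => (w i : ℤ)) d

/-- The component of weighted degree `d` of a polynomial. -/
noncomputable abbrev wcomp (K : Type*) [Field K] {n : ℕ} (w : Fin n → ℕ) (d : ℤ) :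
    MvPolynomial (Fin n) K →ₗ[K] MvPolynomial (Fin n) K :=
  weightedHomogeneousComponent (fun i => (w i : ℤ)) d

theorem weight_nonneg (w : Fin n → ℕ) (m : Fin n →₀ ℕ) :
    0 ≤ Finsupp.weight (fun i => (w i : ℤ)) m := by
  rw [Finsupp.weight_apply, Finsupp.sum]
  exact Finset.sum_nonneg fun i _ => by positivity

theorem degree_le_weight (hw : ∀ i, 0 < w i) (m : Fin n →₀ ℕ) :
    (m.degree : ℤ) ≤ Finsupp.weight (fun i => (w i : ℤ)) m := by
  rw [Finsupp.weight_apply, Finsupp.sum, Finsupp.degree_apply, Nat.cast_sum]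
  refine Finset.sum_le_sum fun i _ => ?_
  have := hw i
  rw [nsmul_eq_mul]
  exact le_mul_of_one_le_right (by positivity) (by exact_mod_cast this)

theorem wcomp_mul {a b : ℤ} {f : MvPolynomial (Fin n) K} (hf : f ∈ whom K w a)
    (p : MvPolynomial (Fin n) K) : wcomp K w (a + b) (f * p) = f * wcomp K w b p := by
  classical
  let : GradedAlgebra (weightedHomogeneousSubmodule K fun i => (w i : ℤ)) :=
    weightedGradedAlgebra K (fun i => (w i : ℤ))
  have := DirectSum.coe_decompose_mul_add_of_left_mem
    (weightedHomogeneousSubmodule K fun i => (w i : ℤ)) (i := a) (j := b) (a := f) (b := p) hf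
  have key : ∀ q m, ((DirectSum.decompose (weightedHomogeneousSubmodule K fun i => (w i : ℤ)) q m :
      weightedHomogeneousSubmodule K (fun i => (w i : ℤ)) m) : MvPolynomial (Fin n) K) =
      wcomp K w m q := fun q m => MvPolynomial.decompose'_apply K _ q m
  rw [key, key] at this
  exact this

theorem wcomp_pderiv (b : ℤ) (i : Fin n) (p : MvPolynomial (Fin n) K) :
    wcomp K w b (pderiv i p) = pderiv i (wcomp K w (b + w i) p) := by
  classical
  ext m
  rw [coeff_weightedHomogeneousComponent, coeff_pderiv, coeff_pderiv,
    coeff_weightedHomogeneousComponent, map_add, Finsupp.weight_single]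
  simp [ite_mul]

theorem wcomp_eq_self {d : ℤ} {p : MvPolynomial (Fin n) K} (hp : p ∈ whom K w d) :
    wcomp K w d p = p :=
  weightedHomogeneousComponent_eq_self hp

theorem wcomp_mem (d : ℤ) (p : MvPolynomial (Fin n) K) : wcomp K w d p ∈ whom K w d :=
  weightedHomogeneousComponent_mem _ _ _

theorem whom_eq_bot {d : ℤ} (hd : d < 0) : whom K w d = ⊥ := by
  rw [eq_bot_iff]
  intro p hp
  rw [Submodule.mem_bot]
  ext m
  refine IsWeightedHomogeneous.coeff_eq_zero hp m ?_
  have := weight_nonneg w m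
  omega

instance finite_whom [Fact (∀ i, 0 < w i)] (d : ℤ) : Module.Finite K (whom K w d) := by
  have hw : ∀ i, 0 < w i := Fact.out
  rcases lt_or_ge d 0 with hd | hd
  · rw [whom_eq_bot hd]
    infer_instance
  · lift d to ℕ using hd
    have : whom K w d = weightedHomogeneousSubmodule K w d := by
      ext p
      simp only [mem_weightedHomogeneousSubmodule, IsWeightedHomogeneous]
      refine forall_congr' fun m => forall_congr' fun _ => ?_
      rw [Finsupp.weight_apply, Finsupp.weight_apply, Finsupp.sum, Finsupp.sum]
      simp only [nsmul_eq_mul, smul_eq_mul]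
      norm_cast
    rw [this, Module.Finite.iff_fg]
    exact weightedHomogeneousSubmodule_fg K w (fun i => (hw i).ne') d

theorem pderiv_mem_whom {N : ℤ} {f : MvPolynomial (Fin n) K} (hf : f ∈ whom K w N) (i : Fin n) :
    pderiv i f ∈ whom K w (N - w i) :=
  IsWeightedHomogeneous.pderiv (w := fun i => (w i : ℤ)) hf (sub_add_cancel N (w i : ℤ))

/-- Euler's identity, checked on coefficients: the operator multiplies the coefficient at `m` by `∑
wᵢ mᵢ`, which is `N` wherever `f` has a nonzero coefficient. -/
theorem sum_weight_mul_X_mul_pderiv {N : ℤ} {f : MvPolynomial (Fin n) K} (hf : f ∈ whom K w N) :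
    ∑ i, (w i : MvPolynomial (Fin n) K) * X i * pderiv i f = (N : MvPolynomial (Fin n) K) * f := by
  ext m
  have h : ∀ i : Fin n, coeff m ((w i : MvPolynomial (Fin n) K) * X i * pderiv i f) =
      w i * m i * coeff m f := by
    intro i
    rw [← map_natCast (C : K →+* MvPolynomial (Fin n) K), mul_assoc, coeff_C_mul, coeff_X_mul']
    split_ifs with hi
    · have hle : Finsupp.single i 1 ≤ m := by
        rw [Finsupp.single_le_iff]
        exact Nat.one_le_iff_ne_zero.2 (Finsupp.mem_support_iff.1 hi)
      rw [coeff_pderiv, tsub_add_cancel_of_le hle]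
      have : (((m - Finsupp.single i 1 : Fin n →₀ ℕ) i : ℕ) : K) + 1 = m i := by
        have h1 := hle i
        rw [Finsupp.single_eq_same] at h1
        rw [Finsupp.tsub_apply, Finsupp.single_eq_same]
        push_cast [h1]
        ring
      rw [this]
      ring
    · rw [Finsupp.notMem_support_iff.1 hi]
      simp
  rw [coeff_sum, Finset.sum_congr rfl fun i _ => h i, ← Finset.sum_mul,
    ← map_intCast (C : K →+* MvPolynomial (Fin n) K), coeff_C_mul]
  by_cases hm : coeff m f = 0
  · simp [hm]
  · congr 1
    rw [← hf hm, Finsupp.weight_apply, Finsupp.sum_fintype _ _ (by simp)]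
    push_cast
    refine Finset.sum_congr rfl fun i _ => ?_
    rw [nsmul_eq_mul]
    push_cast
    ring

/-- Weights are nonnegative, so multiplication cannot lower degree: the ideal has no nonzero
coefficient in weight at most `e`. -/
theorem eq_zero_of_mem_span_of_degree_lt {ι : Type*} {θ : ι → MvPolynomial (Fin n) K} {δ : ι → ℤ}
    (hθ : ∀ j, θ j ∈ whom K w (δ j)) {S : Set ι} {e : ℤ} (he : ∀ j ∈ S, e < δ j)
    {q : MvPolynomial (Fin n) K} (hq : q ∈ whom K w e) (hqS : q ∈ Ideal.span (θ '' S)) : q = 0 := by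
  have key : ∀ m, Finsupp.weight (fun i => (w i : ℤ)) m ≤ e → coeff m q = 0 := by
    refine Submodule.span_induction (p := fun q _ => ∀ m,
      Finsupp.weight (fun i => (w i : ℤ)) m ≤ e → coeff m q = 0) ?_ ?_ ?_ ?_ hqS
    · rintro _ ⟨j, hj, rfl⟩ m hm
      exact IsWeightedHomogeneous.coeff_eq_zero (hθ j) m (by have := he j hj; omega)
    · simp
    · intro x y _ _ hx hy m hm
      rw [coeff_add, hx m hm, hy m hm, add_zero]
    · intro a x _ hx m hm
      rw [smul_eq_mul, coeff_mul]
      refine Finset.sum_eq_zero fun p hp => ?_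
      have hp' := Finset.HasAntidiagonal.mem_antidiagonal.1 hp
      rw [hx p.2, mul_zero]
      rw [← hp', map_add] at hm
      have := weight_nonneg w p.1
      omega
  ext m
  rw [coeff_zero]
  by_cases hm : Finsupp.weight (fun i => (w i : ℤ)) m = e
  · exact key m hm.le
  · exact IsWeightedHomogeneous.coeff_eq_zero hq m hm

end WeightedPolynomials

/-! ### The operator `T` and the Jacobian ideal -/

section TwistedDivergence

variable {K A : Type*} [CommRing K] [CommRing A] [Algebra K A] {n : ℕ}

/-- The operator `X ↦ f div X - X.f` on vector fields. -/
noncomputable def twistedDiv (D : Fin n → Derivation K A A) (f : A) : (Fin n → A) →ₗ[K] A where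
  toFun X := f * ∑ i, D i (X i) - ∑ i, X i * D i f
  map_add' X Y := by
    simp only [Pi.add_apply, map_add, Finset.sum_add_distrib, add_mul]
    ring
  map_smul' c X := by
    simp only [Pi.smul_apply, Derivation.map_smul, RingHom.id_apply, smul_sub, ← Finset.smul_sum,
      mul_smul_comm, smul_mul_assoc]

theorem twistedDiv_apply (D : Fin n → Derivation K A A) (f : A) (X : Fin n → A) :
    twistedDiv D f X = f * ∑ i, D i (X i) - ∑ i, X i * D i f := rfl

/-- The ideal generated by the partial derivatives of `f`. -/
abbrev jacobianIdeal (D : Fin n → Derivation K A A) (f : A) : Ideal A :=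
  Ideal.span (Set.range fun i => D i f)

theorem mem_jacobianIdeal_iff (D : Fin n → Derivation K A A) (f g : A) :
    g ∈ jacobianIdeal D f ↔ ∃ X : Fin n → A, ∑ i, X i * D i f = g :=
  Ideal.mem_span_range_iff_exists_fun

end TwistedDivergence

/-! ### Injectivity of `h ↦ f h`, polynomial case -/

section PolynomialUniqueness

open MvPolynomial

variable {K : Type*} [Field K] {n : ℕ} {w : Fin n → ℕ}

/-- `T` is graded once `∂ᵢ` is given weight `-wᵢ`: it raises the degree of a vector field by `N`. -/
theorem wcomp_twistedDiv {N b : ℤ} {f : MvPolynomial (Fin n) K} (hf : f ∈ whom K w N)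
    (P : Fin n → MvPolynomial (Fin n) K) :
    wcomp K w (N + b) (twistedDiv (fun i => pderiv i) f P) =
      twistedDiv (fun i => pderiv i) f fun i => wcomp K w (b + w i) (P i) := by
  rw [twistedDiv_apply, twistedDiv_apply, map_sub, wcomp_mul hf, map_sum, map_sum]
  congr 2
  · exact Finset.sum_congr rfl fun i _ => wcomp_pderiv b i (P i)
  · refine funext fun i => ?_
    rw [mul_comm, mul_comm (wcomp K w _ _), ← wcomp_mul (pderiv_mem_whom hf i)]
    congr 2
    ring

/-- A quasihomogeneous polynomial with a zero-dimensional Jacobian ideal and no constant term has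
nonzero degree. -/
theorem degree_ne_zero {N : ℤ} {f : MvPolynomial (Fin n) K} (hw : ∀ i, 0 < w i) (hn : 0 < n)
    (hf : f ∈ whom K w N) (hf0 : constantCoeff f = 0) (e : Fin n → ℕ)
    (he : ∀ i, X i ^ e i ∈ jacobianIdeal (fun i => pderiv i) f) : N ≠ 0 := by
  rintro rfl
  have hf' : f = 0 := by
    ext m
    rw [coeff_zero]
    by_cases hm : m = 0
    · rw [hm]
      exact hf0
    · refine IsWeightedHomogeneous.coeff_eq_zero hf m ?_
      have h₁ := degree_le_weight hw m
      have h₂ : m.degree ≠ 0 := by rwa [ne_eq, Finsupp.degree_eq_zero_iff]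
      omega
  have := he ⟨0, hn⟩
  rw [mem_jacobianIdeal_iff] at this
  obtain ⟨Y, hY⟩ := this
  simp only [hf', map_zero, mul_zero, Finset.sum_const_zero] at hY
  exact pow_ne_zero _ (X_ne_zero _) hY.symm

theorem eq_zero_of_mul_eq_twistedDiv [CharZero K] {N : ℤ} {f : MvPolynomial (Fin n) K} (hn : 3 ≤ n)
    (hw : ∀ i, 0 < w i) (hN : N ≠ 0) (hf : f ∈ whom K w N) (e : Fin n → ℕ)
    (he : ∀ i, X i ^ e i ∈ jacobianIdeal (fun i => pderiv i) f) {h : MvPolynomial (Fin n) K}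
    (hh : h ∈ whom K w (N - ∑ i, (w i : ℤ))) {P : Fin n → MvPolynomial (Fin n) K}
    (hP : ∀ i, P i ∈ whom K w (N - ∑ i, (w i : ℤ) + w i))
    (hfh : f * h = twistedDiv (fun i => pderiv i) f P) : h = 0 := by
  set d : ℤ := N - ∑ i, (w i : ℤ) with hd
  have hNK : (N : K) ≠ 0 := Int.cast_ne_zero.2 hN
  set g := ∑ i, pderiv i (P i) - h with hg
  have hgd : g ∈ whom K w d := by
    refine sub_mem (sum_mem fun i _ => ?_) hh
    have := pderiv_mem_whom (hP i) i
    rwa [add_sub_cancel_right] at this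
  have hPf : ∑ i, P i * pderiv i f = f * g := by
    rw [twistedDiv_apply] at hfh
    rw [hg, mul_sub, hfh]
    ring
  set c : MvPolynomial (Fin n) K := C (N : K)⁻¹ with hc
  have hcN : c * (N : MvPolynomial (Fin n) K) = 1 := by
    rw [hc, ← map_intCast (C : K →+* MvPolynomial (Fin n) K), ← map_mul, inv_mul_cancel₀ hNK,
      map_one]
  -- By Euler's identity `(g / N) E` also sends `f` to `f g`, so the difference with `P` is a syzygy
  -- of the partials.
  have hY0 : ∀ i, P i - c * g * ((w i : MvPolynomial (Fin n) K) * X i) = 0 := by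
    intro i
    have hsyz : ∑ i, (P i - c * g * ((w i : MvPolynomial (Fin n) K) * X i)) * pderiv i f = 0 := by
      simp only [sub_mul, Finset.sum_sub_distrib, hPf, mul_assoc c, mul_assoc g, ← Finset.mul_sum]
      rw [sum_weight_mul_X_mul_pderiv hf]
      linear_combination (-(f * g)) * hcN
    have hmem := mvPolynomial_syzygy_mem_span (fun i => pderiv i f) e he _ hsyz i
    refine eq_zero_of_mem_span_of_degree_lt (w := w) (δ := fun j => N - w j) (e := d + w i)
      (fun j => pderiv_mem_whom hf j) ?_ (sub_mem (hP i) ?_) hmem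
    · intro j hj
      have hji : j ≠ i := hj
      -- The inequality `d + wᵢ < N - wⱼ` amounts to `wᵢ + wⱼ < ∑ w`, so a third index is needed;
      -- this is the use of `n ≥ 3`.
      obtain ⟨k, hk⟩ : ∃ k, k ∉ ({i, j} : Finset (Fin n)) := by
        by_contra hcon
        push Not at hcon
        have h₁ := Finset.card_le_card (fun k _ => hcon k : (Finset.univ : Finset (Fin n)) ⊆ {i, j})
        rw [Finset.card_univ, Fintype.card_fin] at h₁
        have h₂ := Finset.card_le_two (a := i) (b := j)
        omega
      simp only [Finset.mem_insert, Finset.mem_singleton, not_or] at hk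
      have h₃ : ∑ l ∈ ({i, j, k} : Finset (Fin n)), (w l : ℤ) ≤ ∑ l, (w l : ℤ) :=
        Finset.sum_le_sum_of_subset_of_nonneg (Finset.subset_univ _) fun _ _ _ => by positivity
      rw [Finset.sum_insert (by simp [hji.symm, Ne.symm hk.1]),
        Finset.sum_insert (by simp [Ne.symm hk.2]), Finset.sum_singleton] at h₃
      have := hw k
      simp only [hd]
      omega
    · have h₁ : c * g ∈ whom K w d := by
        rw [hc, ← smul_eq_C_mul]
        exact Submodule.smul_mem _ _ hgd
      have h₂ : (w i : MvPolynomial (Fin n) K) * X i ∈ whom K w (w i) := by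
        rw [← map_natCast (C : K →+* MvPolynomial (Fin n) K), ← smul_eq_C_mul]
        exact Submodule.smul_mem _ _ (isWeightedHomogeneous_X K (fun i => (w i : ℤ)) i)
      exact IsWeightedHomogeneous.mul h₁ h₂
  -- The divergence of `(g / N) E` is `(∑ w + d) g / N`, and `∑ w + d = N`.
  have hdiv : ∑ i, pderiv i (P i) = g := by
    have h₁ : ∀ i, pderiv i (P i) = c * ((w i : MvPolynomial (Fin n) K) * g +
        (w i : MvPolynomial (Fin n) K) * X i * pderiv i g) := by
      intro i
      rw [sub_eq_zero.1 (hY0 i), hc, mul_assoc (C _), ← smul_eq_C_mul, Derivation.map_smul,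
        smul_eq_C_mul]
      simp only [Derivation.leibniz, smul_eq_mul, pderiv_X_self, Derivation.map_natCast]
      ring
    rw [Finset.sum_congr rfl fun i _ => h₁ i, ← Finset.mul_sum, Finset.sum_add_distrib,
      sum_weight_mul_X_mul_pderiv hgd, ← Finset.sum_mul]
    have h₂ : (∑ i, (w i : MvPolynomial (Fin n) K)) + (d : MvPolynomial (Fin n) K) = N := by
      rw [hd]
      push_cast
      ring
    linear_combination (c * g) * h₂ + g * hcN
  have : h = ∑ i, pderiv i (P i) - g := by rw [hg]; ring
  rw [this, hdiv, sub_self]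

end PolynomialUniqueness

/-! ### The exact sequence over an abstract function algebra -/

section LocalCalculus

open MvPolynomial

variable {K A : Type*} [Field K] [CommRing A] [Algebra K A] {n : ℕ}

/-- What is used of an algebra `A` of functions of `n` variables near `0`, with partial derivatives
`D i` and coordinates `x i`: Hadamard's lemma, and the solvability of `E h + (a + 1) h = φ` for the
Euler fields `E` with positive weights. -/
structure IsLocalCalculus (D : Fin n → Derivation K A A) (x : Fin n → A) : Prop where
  partial_coord : ∀ i j, D i (x j) = Pi.single (M := fun _ => A) i 1 j
  hadamard : ∃ ev : A →ₐ[K] K, (∀ i, ev (x i) = 0) ∧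
    ∀ φ, ∃ ψ : Fin n → A, φ = algebraMap K A (ev φ) + ∑ i, x i * ψ i
  exists_euler_add : ∀ w : Fin n → ℕ, (∀ i, 0 < w i) → ∀ (a : ℕ) (φ : A),
    ∃ h, ∑ i, (w i : A) * x i * D i h + (a + 1 : A) * h = φ

namespace IsLocalCalculus

variable {D : Fin n → Derivation K A A} {x : Fin n → A}

theorem partial_aeval (hD : IsLocalCalculus D x) (i : Fin n) (p : MvPolynomial (Fin n) K) :
    D i (aeval x p) = aeval x (pderiv i p) := by
  induction p using MvPolynomial.induction_on with
  | C a => simp [← algebraMap_eq]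
  | add p q hp hq => simp [hp, hq]
  | mul_X p j hp =>
    simp only [map_mul, aeval_X, Derivation.leibniz, smul_eq_mul, map_add, hp, hD.partial_coord,
      pderiv_X]
    congr 2
    by_cases h : i = j
    · subst h
      simp
    · simp [Ne.symm h]

theorem aeval_twistedDiv (hD : IsLocalCalculus D x) (f : MvPolynomial (Fin n) K)
    (P : Fin n → MvPolynomial (Fin n) K) :
    aeval x (twistedDiv (fun i => pderiv i) f P) =
      twistedDiv D (aeval x f) fun i => aeval x (P i) := by
  simp only [twistedDiv_apply, map_sub, map_mul, map_sum, hD.partial_aeval]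

theorem euler_aeval (hD : IsLocalCalculus D x) {w : Fin n → ℕ} {N : ℤ}
    {f : MvPolynomial (Fin n) K} (hf : f ∈ whom K w N) :
    ∑ i, (w i : A) * x i * D i (aeval x f) = (N : A) * aeval x f := by
  have := congrArg (aeval x) (sum_weight_mul_X_mul_pderiv hf)
  simpa [hD.partial_aeval] using this

/-- `E - e` is onto up to quasihomogeneous polynomials of degree `e`. For `e < 0` it is onto by
assumption. Otherwise Hadamard's lemma and `(E - e)(xᵢ h) = xᵢ (E - (e - wᵢ)) h` lower `e` until it
is negative. -/
theorem exists_euler_sub [CharZero K] (hD : IsLocalCalculus D x) {w : Fin n → ℕ}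
    (hw : ∀ i, 0 < w i) (e : ℤ) (φ : A) :
    ∃ h, ∃ P ∈ whom K w e, φ = ∑ i, (w i : A) * x i * D i h - (e : A) * h + aeval x P := by
  obtain ⟨ev, -, had⟩ := hD.hadamard
  have key : ∀ k : ℕ, ∀ e : ℤ, e < k → ∀ φ : A, ∃ h, ∃ P ∈ whom K w e,
      φ = ∑ i, (w i : A) * x i * D i h - (e : A) * h + aeval x P := by
    intro k
    induction k with
    | zero =>
      intro e he φ
      obtain ⟨a, rfl⟩ : ∃ a : ℕ, e = -(a + 1) := ⟨(-e - 1).toNat, by omega⟩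
      obtain ⟨h, hh⟩ := hD.exists_euler_add w hw a φ
      refine ⟨h, 0, zero_mem _, ?_⟩
      rw [← hh, map_zero, add_zero]
      push_cast
      ring
    | succ k ih =>
      intro e he φ
      obtain ⟨ψ, hψ⟩ := had φ
      have hlt : ∀ i, e - w i < k := fun i => by have := hw i; omega
      choose h P hP hhP using fun i => ih (e - w i) (hlt i) (ψ i)
      -- Constants are hit by `E - e` unless `e = 0`, and then they are themselves quasihomogeneous
      -- of degree `e`.
      have hconst : ∃ c : K, ∃ P₀ ∈ whom K w e,
          algebraMap K A (ev φ) = -((e : A) * algebraMap K A c) + aeval x P₀ := by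
        by_cases he0 : e = 0
        · refine ⟨0, C (ev φ), ?_, ?_⟩
          · rw [he0]
            exact isWeightedHomogeneous_C _ _
          · simp [← algebraMap_eq]
        · refine ⟨-((e : K)⁻¹ * ev φ), 0, zero_mem _, ?_⟩
          have : (e : K) ≠ 0 := Int.cast_ne_zero.2 he0
          rw [map_zero, add_zero, ← map_intCast (algebraMap K A), ← map_mul, ← map_neg]
          congr 1
          field_simp
      obtain ⟨c, P₀, hP₀, hc⟩ := hconst
      refine ⟨algebraMap K A c + ∑ i, x i * h i, P₀ + ∑ i, X i * P i, ?_, ?_⟩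
      · refine add_mem hP₀ (sum_mem fun i _ => ?_)
        have := IsWeightedHomogeneous.mul (isWeightedHomogeneous_X K (fun i => (w i : ℤ)) i) (hP i)
        rwa [add_sub_cancel] at this
      · have hE : ∑ i, (w i : A) * x i * D i (algebraMap K A c + ∑ j, x j * h j) =
            ∑ j, (x j * ∑ i, (w i : A) * x i * D i (h j) + w j * x j * h j) := by
          have : ∀ i, D i (algebraMap K A c + ∑ j, x j * h j) = ∑ j, x j * D i (h j) + h i := by
            intro i
            simp only [map_add, Derivation.map_algebraMap, zero_add, map_sum, Derivation.leibniz,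
              smul_eq_mul, hD.partial_coord, Finset.sum_add_distrib]
            congr 1
            simp [Pi.single_apply]
          simp only [this, mul_add, Finset.sum_add_distrib, Finset.mul_sum]
          rw [Finset.sum_comm]
          congr 1
          exact Finset.sum_congr rfl fun i _ => Finset.sum_congr rfl fun j _ => by ring
        have hψ' : ∀ i, x i * ψ i = x i * ∑ j, (w j : A) * x j * D j (h i) + w i * x i * h i -
            (e : A) * (x i * h i) + x i * aeval x (P i) := by
          intro i
          rw [hhP i]
          push_cast
          ring
        rw [hE]
        conv_lhs => rw [hψ, hc, Finset.sum_congr rfl fun i _ => hψ' i]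
        simp only [map_add, map_sum, map_mul, aeval_X, Finset.sum_add_distrib,
          Finset.sum_sub_distrib, mul_add, Finset.mul_sum]
        ring
  exact key (e + 1).toNat e (by omega) φ

/-- The ideal of functions vanishing at `0`. -/
abbrev maxIdeal (x : Fin n → A) : Ideal A := Ideal.span (Set.range x)

theorem coord_mem_maxIdeal (i : Fin n) : x i ∈ maxIdeal x := Ideal.subset_span ⟨i, rfl⟩

theorem exists_poly_sub_mem (hD : IsLocalCalculus D x) (k : ℕ) (φ : A) :
    ∃ P : MvPolynomial (Fin n) K, φ - aeval x P ∈ maxIdeal x ^ k := by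
  obtain ⟨ev, -, had⟩ := hD.hadamard
  induction k generalizing φ with
  | zero => exact ⟨0, by simp⟩
  | succ k ih =>
    obtain ⟨ψ, hψ⟩ := had φ
    choose P hP using fun i => ih (ψ i)
    refine ⟨C (ev φ) + ∑ i, X i * P i, ?_⟩
    have : φ - aeval x (C (ev φ) + ∑ i, X i * P i) = ∑ i, x i * (ψ i - aeval x (P i)) := by
      simp only [map_add, map_sum, map_mul, aeval_X, aeval_C, mul_sub, Finset.sum_sub_distrib]
      linear_combination hψ
    rw [this, pow_succ']
    exact sum_mem fun i _ => Ideal.mul_mem_mul (coord_mem_maxIdeal i) (hP i)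

theorem partial_mem_pow (i : Fin n) (k : ℕ) {φ : A}
    (hφ : φ ∈ maxIdeal x ^ (k + 1)) : D i φ ∈ maxIdeal x ^ k := by
  induction k generalizing φ with
  | zero => simp
  | succ k ih =>
    rw [pow_succ] at hφ
    refine Submodule.mul_induction_on hφ ?_ ?_
    · intro a ha b hb
      rw [Derivation.leibniz, smul_eq_mul, smul_eq_mul]
      refine add_mem (Ideal.mul_mem_right _ _ ha) ?_
      rw [pow_succ, mul_comm b]
      rw [mul_comm (maxIdeal x ^ k), mul_comm (D i a)]
      exact Ideal.mul_mem_mul hb (ih ha)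
    · intro a b ha hb
      rw [map_add]
      exact add_mem ha hb

/-- Coefficients are recovered by differentiating and evaluating at `0`; each derivative costs one
power of the maximal ideal, and characteristic zero removes the factors produced. -/
theorem coeff_eq_zero_of_aeval_mem_pow [CharZero K] (hD : IsLocalCalculus D x) (k : ℕ)
    {p : MvPolynomial (Fin n) K} (hp : aeval x p ∈ maxIdeal x ^ k) (m : Fin n →₀ ℕ)
    (hm : m.degree < k) : coeff m p = 0 := by
  obtain ⟨ev, hev, -⟩ := hD.hadamard
  induction k generalizing p m with
  | zero => omega
  | succ k ih =>
    by_cases hm0 : m = 0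
    · have h₁ : aeval x p ∈ RingHom.ker ev := by
        refine (Ideal.span_le.2 ?_ : maxIdeal x ≤ RingHom.ker ev)
          (Ideal.pow_le_self k.succ_ne_zero hp)
        rintro _ ⟨i, rfl⟩
        exact hev i
      have h₂ : ev (aeval x p) = constantCoeff p := by
        rw [← AlgHom.comp_apply, comp_aeval]
        have : (fun i => ev (x i)) = 0 := funext hev
        rw [this, aeval_zero]
        rfl
      rw [hm0, ← constantCoeff_eq, ← h₂]
      exact h₁
    · obtain ⟨i, hi⟩ := Finsupp.ne_iff.1 hm0
      have hle : Finsupp.single i 1 ≤ m := by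
        rw [Finsupp.single_le_iff]
        exact Nat.one_le_iff_ne_zero.2 hi
      have h₁ := partial_mem_pow (D := D) i k hp
      rw [hD.partial_aeval] at h₁
      have hdeg : (m - Finsupp.single i 1).degree < k := by
        have : (m - Finsupp.single i 1 + Finsupp.single i 1).degree = m.degree := by
          rw [tsub_add_cancel_of_le hle]
        rw [map_add, Finsupp.degree_single] at this
        omega
      have h₂ := ih h₁ (m - Finsupp.single i 1) hdeg
      rw [coeff_pderiv, tsub_add_cancel_of_le hle] at h₂
      exact (mul_eq_zero.1 h₂).resolve_right (Nat.cast_add_one_ne_zero _)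

theorem wcomp_eq_zero_of_aeval_mem_pow [CharZero K] (hD : IsLocalCalculus D x) {w : Fin n → ℕ}
    (hw : ∀ i, 0 < w i) (k : ℕ) {p : MvPolynomial (Fin n) K} (hp : aeval x p ∈ maxIdeal x ^ k)
    {e : ℤ} (he : e < k) : wcomp K w e p = 0 := by
  ext m
  rw [coeff_weightedHomogeneousComponent, coeff_zero]
  split_ifs with hm
  · refine hD.coeff_eq_zero_of_aeval_mem_pow k hp m ?_
    have := degree_le_weight hw m
    omega
  · rfl

variable [CharZero K] {w : Fin n → ℕ} {N : ℤ} {f : MvPolynomial (Fin n) K}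

/-- Descent from germs to polynomials: replacing the coefficients of a relation by polynomials
modulo the power `e + 1` of the maximal ideal does not affect weight `e`, since weight is at least
ordinary degree. -/
theorem wcomp_mem_jacobianIdeal (hD : IsLocalCalculus D x) (hw : ∀ i, 0 < w i)
    (hf : f ∈ whom K w N) {q : MvPolynomial (Fin n) K}
    (hq : aeval x q ∈ jacobianIdeal D (aeval x f)) (e : ℤ) :
    wcomp K w e q ∈ jacobianIdeal (fun i => pderiv i) f := by
  obtain ⟨φ, hφ⟩ := (mem_jacobianIdeal_iff _ _ _).1 hq
  choose P hP using fun i => hD.exists_poly_sub_mem (e + 1).toNat (φ i)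
  have h₁ : aeval x (q - ∑ i, P i * pderiv i f) ∈ maxIdeal x ^ (e + 1).toNat := by
    have : aeval x (q - ∑ i, P i * pderiv i f) =
        ∑ i, (φ i - aeval x (P i)) * D i (aeval x f) := by
      simp only [map_sub, map_sum, map_mul, ← hφ, sub_mul, Finset.sum_sub_distrib,
        hD.partial_aeval]
    rw [this]
    exact sum_mem fun i _ => Ideal.mul_mem_right _ _ (hP i)
  have h₂ := hD.wcomp_eq_zero_of_aeval_mem_pow hw _ h₁ (e := e) (by omega)
  rw [map_sub, map_sum, sub_eq_zero] at h₂
  rw [h₂]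
  refine sum_mem fun i _ => ?_
  have h₃ := wcomp_mul (pderiv_mem_whom hf i) (P i) (b := e - (N - w i))
  rw [add_sub_cancel, mul_comm] at h₃
  rw [h₃]
  exact Ideal.mul_mem_right _ _ (Ideal.subset_span ⟨i, rfl⟩)

theorem exists_X_pow_mem_jacobianIdeal (hD : IsLocalCalculus D x) (hw : ∀ i, 0 < w i)
    (hf : f ∈ whom K w N) (hfin : Module.Finite K (Milnor D (aeval x f))) (i : Fin n) :
    ∃ k, X i ^ k ∈ jacobianIdeal (fun i => pderiv i) f := by
  set p := minpoly K (Ideal.Quotient.mk (jacobianIdeal D (aeval x f)) (x i))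
  have hmonic : p.Monic := minpoly.monic (Algebra.IsIntegral.isIntegral _)
  have h₁ : aeval x (Polynomial.aeval (X i : MvPolynomial (Fin n) K) p) ∈
      jacobianIdeal D (aeval x f) := by
    rw [← Polynomial.aeval_algHom_apply, aeval_X, ← Ideal.Quotient.eq_zero_iff_mem,
      ← Ideal.Quotient.mkₐ_eq_mk K, ← Polynomial.aeval_algHom_apply]
    exact minpoly.aeval _ _
  refine ⟨p.natDegree, ?_⟩
  -- A monic annihilating polynomial of the class of `x i` has terms of distinct weights `j * w i`;
  -- the top component isolates the leading power of `X i`.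
  have h₂ := hD.wcomp_mem_jacobianIdeal hw hf h₁ (p.natDegree * w i)
  convert h₂ using 1
  rw [Polynomial.aeval_eq_sum_range, map_sum, Finset.sum_range_succ, Finset.sum_eq_zero,
    zero_add]
  · rw [hmonic.coeff_natDegree, one_smul]
    refine (wcomp_eq_self ?_).symm
    have := (isWeightedHomogeneous_X K (fun i => (w i : ℤ)) i).pow p.natDegree
    simpa using this
  · intro j hj
    rw [map_smul]
    have h₃ := (isWeightedHomogeneous_X K (fun i => (w i : ℤ)) i).pow j
    rw [h₃.weightedHomogeneousComponent_ne, smul_zero]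
    rw [nsmul_eq_mul]
    have := hw i
    have hj' := Finset.mem_range.1 hj
    intro hcon
    have : p.natDegree * w i = j * w i := by exact_mod_cast hcon
    exact hj'.ne (Nat.eq_of_mul_eq_mul_right (hw i) this.symm)

theorem degree_ne_zero (hD : IsLocalCalculus D x) (hn : 0 < n) (hw : ∀ i, 0 < w i)
    (hf : f ∈ whom K w N) (hf0 : constantCoeff f = 0)
    (hfin : Module.Finite K (Milnor D (aeval x f))) : N ≠ 0 := by
  choose e he using hD.exists_X_pow_mem_jacobianIdeal hw hf hfin
  exact NambuGerm.degree_ne_zero hw hn hf hf0 e he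

theorem eq_zero_of_aeval_mul_mem_range (hD : IsLocalCalculus D x) (hn : 3 ≤ n)
    (hw : ∀ i, 0 < w i) (hf : f ∈ whom K w N) (hf0 : constantCoeff f = 0)
    (hfin : Module.Finite K (Milnor D (aeval x f))) {h : MvPolynomial (Fin n) K}
    (hh : h ∈ whom K w (N - ∑ i, (w i : ℤ)))
    (hfh : aeval x (f * h) ∈ LinearMap.range (twistedDiv D (aeval x f))) : h = 0 := by
  choose e he using hD.exists_X_pow_mem_jacobianIdeal hw hf hfin
  have hN := hD.degree_ne_zero (by omega) hw hf hf0 hfin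
  obtain ⟨Y, hY⟩ := hfh
  set d : ℤ := N - ∑ i, (w i : ℤ)
  set k := (N + d + 1).toNat
  -- Order `k + 1` rather than `k`, because the divergence loses one order; `k` itself exceeds the
  -- weight `N + d` to be extracted.
  choose P hP using fun i => hD.exists_poly_sub_mem (k + 1) (Y i)
  have h₁ : aeval x (f * h - twistedDiv (fun i => pderiv i) f P) ∈ maxIdeal x ^ k := by
    rw [map_sub, hD.aeval_twistedDiv, ← hY, ← map_sub, twistedDiv_apply]
    refine sub_mem (Ideal.mul_mem_left _ _ (sum_mem fun i _ => ?_)) (sum_mem fun i _ => ?_)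
    · exact partial_mem_pow i k (hP i)
    · exact Ideal.mul_mem_right _ _ (Ideal.pow_le_pow_right (Nat.le_succ k) (hP i))
  have h₂ := hD.wcomp_eq_zero_of_aeval_mem_pow hw k h₁ (e := N + d) (by omega)
  rw [map_sub, sub_eq_zero, wcomp_mul hf, wcomp_eq_self hh, wcomp_twistedDiv hf] at h₂
  exact eq_zero_of_mul_eq_twistedDiv hn hw hN hf e he hh (fun i => wcomp_mem _ _) h₂

theorem aeval_mem_jacobianIdeal (hD : IsLocalCalculus D x) (hN : N ≠ 0) (hf : f ∈ whom K w N) :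
    aeval x f ∈ jacobianIdeal D (aeval x f) := by
  have h := hD.euler_aeval hf
  have hNK : (N : K) ≠ 0 := Int.cast_ne_zero.2 hN
  have : aeval x f = algebraMap K A (N : K)⁻¹ * ∑ i, (w i : A) * x i * D i (aeval x f) := by
    rw [h, ← map_intCast (algebraMap K A), ← mul_assoc, ← map_mul, inv_mul_cancel₀ hNK, map_one,
      one_mul]
  suffices h' : algebraMap K A (N : K)⁻¹ * ∑ i, (w i : A) * x i * D i (aeval x f) ∈
      jacobianIdeal D (aeval x f) by rwa [← this] at h'
  exact Ideal.mul_mem_left _ _ (sum_mem fun i _ => Ideal.mul_mem_left _ _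
    (Ideal.subset_span ⟨i, rfl⟩))

theorem twistedDiv_mem_jacobianIdeal (hD : IsLocalCalculus D x) (hN : N ≠ 0)
    (hf : f ∈ whom K w N) (Y : Fin n → A) :
    twistedDiv D (aeval x f) Y ∈ jacobianIdeal D (aeval x f) :=
  sub_mem (Ideal.mul_mem_right _ _ (hD.aeval_mem_jacobianIdeal hN hf))
    (sum_mem fun i _ => Ideal.mul_mem_left _ _ (Ideal.subset_span ⟨i, rfl⟩))

theorem exists_sub_mem_range_of_mem_jacobianIdeal (hD : IsLocalCalculus D x)
    (hw : ∀ i, 0 < w i) (hf : f ∈ whom K w N) {φ : A} (hφ : φ ∈ jacobianIdeal D (aeval x f)) :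
    ∃ h ∈ whom K w (N - ∑ i, (w i : ℤ)),
      φ - aeval x (f * h) ∈ LinearMap.range (twistedDiv D (aeval x f)) := by
  obtain ⟨Y, rfl⟩ := (mem_jacobianIdeal_iff _ _ _).1 hφ
  obtain ⟨g, P, hP, hg⟩ := hD.exists_euler_sub hw (N - ∑ i, (w i : ℤ)) (∑ i, D i (Y i))
  -- The vector field `g E - Y`: the first summand supplies `f (E g - d g)`, and the second supplies
  -- `φ - f div Y`.
  refine ⟨P, hP, (fun i => (w i : A) * x i * g) - Y, ?_⟩
  have hE : ∑ i, D i ((w i : A) * x i * g) =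
      (∑ i, (w i : A)) * g + ∑ i, (w i : A) * x i * D i g := by
    rw [Finset.sum_mul, ← Finset.sum_add_distrib]
    refine Finset.sum_congr rfl fun i _ => ?_
    simp only [Derivation.leibniz, smul_eq_mul, Derivation.map_natCast, hD.partial_coord,
      Pi.single_eq_same]
    ring
  have hEf := hD.euler_aeval hf
  have hEf' : ∑ i, (w i : A) * x i * g * D i (aeval x f) = g * ((N : A) * aeval x f) := by
    rw [← hEf, Finset.mul_sum]
    exact Finset.sum_congr rfl fun i _ => by ring
  rw [map_sub, twistedDiv_apply, twistedDiv_apply, hE, hEf', map_mul, hg]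
  push_cast
  ring

/-- The map `h ↦ f h` onto the kernel of `A / range T → Q_f`, `T X = f div X - X.f`. -/
noncomputable def mulToQuotient (D : Fin n → Derivation K A A) (x : Fin n → A)
    (f : MvPolynomial (Fin n) K) (d : ℤ) (w : Fin n → ℕ) :
    whom K w d →ₗ[K] A ⧸ LinearMap.range (twistedDiv D (aeval x f)) :=
  (Submodule.mkQ _) ∘ₗ (aeval x).toLinearMap ∘ₗ (LinearMap.mulLeft K f) ∘ₗ Submodule.subtype _

/-- The map `A / range T → Q_f`, `T X = f div X - X.f`. -/
noncomputable def quotientToMilnor (hD : IsLocalCalculus D x) (hN : N ≠ 0)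
    (hf : f ∈ whom K w N) :
    (A ⧸ LinearMap.range (twistedDiv D (aeval x f))) →ₗ[K] Milnor D (aeval x f) :=
  Submodule.liftQ _ (Ideal.Quotient.mkₐ K (jacobianIdeal D (aeval x f))).toLinearMap (by
    rintro _ ⟨Y, rfl⟩
    exact Ideal.Quotient.eq_zero_iff_mem.2 (hD.twistedDiv_mem_jacobianIdeal hN hf Y))

theorem finite_and_finrank_quotient (hD : IsLocalCalculus D x) (hn : 3 ≤ n)
    (hw : ∀ i, 0 < w i) (hf : f ∈ whom K w N) (hf0 : constantCoeff f = 0)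
    (hfin : Module.Finite K (Milnor D (aeval x f))) :
    Module.Finite K (A ⧸ LinearMap.range (twistedDiv D (aeval x f))) ∧
      Module.finrank K (A ⧸ LinearMap.range (twistedDiv D (aeval x f))) =
        Module.finrank K (Milnor D (aeval x f)) +
          Module.finrank K (whom K w (N - ∑ i, (w i : ℤ))) := by
  have hN := hD.degree_ne_zero (by omega) hw hf hf0 hfin
  have : Fact (∀ i, 0 < w i) := ⟨hw⟩
  set i := mulToQuotient D x f (N - ∑ i, (w i : ℤ)) w
  set q := hD.quotientToMilnor hN hf
  have hi : Function.Injective i := by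
    rw [← LinearMap.ker_eq_bot, eq_bot_iff]
    rintro ⟨h, hh⟩ hker
    have : aeval x (f * h) ∈ LinearMap.range (twistedDiv D (aeval x f)) :=
      (Submodule.Quotient.mk_eq_zero _).1 hker
    exact Subtype.ext (hD.eq_zero_of_aeval_mul_mem_range hn hw hf hf0 hfin hh this)
  have hq : Function.Surjective q := by
    intro y
    obtain ⟨φ, rfl⟩ := Ideal.Quotient.mk_surjective y
    exact ⟨Submodule.Quotient.mk φ, rfl⟩
  have hiq : LinearMap.range i = LinearMap.ker q := by
    refine le_antisymm ?_ ?_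
    · rintro _ ⟨h, rfl⟩
      refine Ideal.Quotient.eq_zero_iff_mem.2 ?_
      change aeval x (f * h.1) ∈ _
      rw [map_mul]
      exact Ideal.mul_mem_right _ _ (hD.aeval_mem_jacobianIdeal hN hf)
    · intro y hy
      obtain ⟨φ, rfl⟩ := Submodule.Quotient.mk_surjective _ y
      have hφ : φ ∈ jacobianIdeal D (aeval x f) := Ideal.Quotient.eq_zero_iff_mem.1 hy
      obtain ⟨h, hh, hφh⟩ := hD.exists_sub_mem_range_of_mem_jacobianIdeal hw hf hφ
      exact ⟨⟨h, hh⟩, ((Submodule.Quotient.eq _).2 hφh).symm⟩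
  have hfinker : Module.Finite K (LinearMap.ker q) := by
    rw [← hiq]
    infer_instance
  have hfinQ : Module.Finite K (A ⧸ LinearMap.range (twistedDiv D (aeval x f))) :=
    have := Module.Finite.equiv (q.quotKerEquivOfSurjective hq).symm
    Module.Finite.of_submodule_quotient (LinearMap.ker q)
  refine ⟨hfinQ, ?_⟩
  rw [← LinearMap.finrank_range_add_finrank_ker q, LinearMap.range_eq_top.2 hq, finrank_top,
    ← hiq, LinearMap.finrank_range_of_inj hi]

theorem existsUnique_normalForm (hD : IsLocalCalculus D x) (hn : 3 ≤ n)
    (hw : ∀ i, 0 < w i) (hf : f ∈ whom K w N) (hf0 : constantCoeff f = 0)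
    (hfin : Module.Finite K (Milnor D (aeval x f))) (B : Set (Fin n →₀ ℕ))
    (hli : LinearIndependent K fun e : B =>
      Ideal.Quotient.mk (jacobianIdeal D (aeval x f)) (aeval x (monomial e.1 (1 : K))))
    (hspan : Submodule.span K (Set.range fun e : B =>
      Ideal.Quotient.mk (jacobianIdeal D (aeval x f)) (aeval x (monomial e.1 (1 : K)))) = ⊤)
    (φ : A) :
    ∃! h : MvPolynomial (Fin n) K × MvPolynomial (Fin n) K,
      h.1 ∈ whom K w (N - ∑ i, (w i : ℤ)) ∧
      h.2 ∈ Submodule.span K ((fun e => monomial e (1 : K)) '' B) ∧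
      φ - aeval x (h.2 + f * h.1) ∈ LinearMap.range (twistedDiv D (aeval x f)) := by
  have hN := hD.degree_ne_zero (by omega) hw hf hf0 hfin
  set L : MvPolynomial (Fin n) K →ₗ[K] Milnor D (aeval x f) :=
    (Ideal.Quotient.mkₐ K (jacobianIdeal D (aeval x f))).toLinearMap ∘ₗ (aeval x).toLinearMap
    with hL
  have hset : (fun e => monomial e (1 : K)) '' B =
      Set.range fun e : B => (monomial e.1 (1 : K) : MvPolynomial (Fin n) K) := by
    rw [Set.image_eq_range]
  rw [hset]
  have hrange : (Set.range fun e : B =>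
      Ideal.Quotient.mk (jacobianIdeal D (aeval x f)) (aeval x (monomial e.1 (1 : K)))) =
      L '' Set.range fun e : B => (monomial e.1 (1 : K) : MvPolynomial (Fin n) K) := by
    rw [← Set.range_comp]
    rfl
  have hinj : ∀ p ∈ Submodule.span K (Set.range fun e : B =>
      (monomial e.1 (1 : K) : MvPolynomial (Fin n) K)), L p = 0 → p = 0 := by
    intro p hp hLp
    obtain ⟨c, rfl⟩ := (Finsupp.mem_span_range_iff_exists_finsupp).1 hp
    have hc : c = 0 := by
      refine linearIndependent_iff.1 hli c ?_
      rw [← hLp, Finsupp.linearCombination_apply, Finsupp.sum, Finsupp.sum, map_sum]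
      refine Finset.sum_congr rfl fun e _ => ?_
      rw [map_smul]
      rfl
    rw [hc, Finsupp.sum_zero_index]
  have hmem : ∀ p, L p = 0 ↔ aeval x p ∈ jacobianIdeal D (aeval x f) :=
    fun p => Ideal.Quotient.eq_zero_iff_mem
  have hfmem : ∀ h, aeval x (f * h) ∈ jacobianIdeal D (aeval x f) := by
    intro h
    rw [map_mul]
    exact Ideal.mul_mem_right _ _ (hD.aeval_mem_jacobianIdeal hN hf)
  obtain ⟨h₂, hh₂, hLh₂⟩ : ∃ p ∈ Submodule.span K (Set.range fun e : B =>
      (monomial e.1 (1 : K) : MvPolynomial (Fin n) K)),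
      L p = Ideal.Quotient.mk (jacobianIdeal D (aeval x f)) φ := by
    have : Ideal.Quotient.mk (jacobianIdeal D (aeval x f)) φ ∈
        (⊤ : Submodule K (Milnor D (aeval x f))) := trivial
    rw [← hspan, hrange, ← Submodule.map_span] at this
    exact this
  have hφ : φ - aeval x h₂ ∈ jacobianIdeal D (aeval x f) := by
    rw [← Ideal.Quotient.eq_zero_iff_mem, map_sub, ← hLh₂]
    exact sub_self _
  obtain ⟨h₁, hh₁, hB⟩ := hD.exists_sub_mem_range_of_mem_jacobianIdeal hw hf hφ
  refine ⟨(h₁, h₂), ⟨hh₁, hh₂, ?_⟩, ?_⟩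
  · rwa [map_add, ← sub_sub]
  · rintro ⟨g₁, g₂⟩ ⟨hg₁, hg₂, hg⟩
    -- Passing to `Q_f` kills the terms in `f` and forces `h₂ = g₂` by independence; then
    -- injectivity of `h ↦ f h` gives `h₁ = g₁`.
    have hdiff : aeval x ((h₂ - g₂) + f * (h₁ - g₁)) ∈
        LinearMap.range (twistedDiv D (aeval x f)) := by
      have := sub_mem hg hB
      convert this using 1
      simp only [map_add, map_sub, map_mul]
      ring
    have hJ : aeval x (h₂ - g₂) ∈ jacobianIdeal D (aeval x f) := by
      obtain ⟨Y, hY⟩ := hdiff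
      have h₃ := sub_mem (hD.twistedDiv_mem_jacobianIdeal hN hf Y) (hfmem (h₁ - g₁))
      rwa [hY, map_add, add_sub_cancel_right] at h₃
    have h₄ := hinj _ (sub_mem hh₂ hg₂) ((hmem _).2 hJ)
    rw [h₄, zero_add] at hdiff
    have h₅ := hD.eq_zero_of_aeval_mul_mem_range hn hw hf hf0 hfin (sub_mem hh₁ hg₁) hdiff
    rw [Prod.mk.injEq]
    exact ⟨(sub_eq_zero.1 h₅).symm, (sub_eq_zero.1 h₄).symm⟩

end IsLocalCalculus

end LocalCalculus

/-! ### Coboundaries and brackets as the range of `T` -/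

section TopDegree

variable {K A : Type*} [CommRing K] [CommRing A] [Algebra K A] {n : ℕ}

/-- An alternating form of top degree is determined by its coefficient. -/
noncomputable def topFormEquiv (K A : Type*) [CommRing K] [CommRing A] [Algebra K A] (n : ℕ) :
    Form A n n ≃ₗ[K] A where
  toFun α := α (stdFrame A n)
  map_add' _ _ := rfl
  map_smul' _ _ := rfl
  invFun a := a • (Pi.basisFun A (Fin n)).det
  left_inv α := form_ext_stdFrame (by
    rw [AlternatingMap.smul_apply, det_stdFrame, smul_eq_mul, mul_one])
  right_inv a := by
    change (a • (Pi.basisFun A (Fin n)).det) (stdFrame A n) = a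
    rw [AlternatingMap.smul_apply, det_stdFrame, smul_eq_mul, mul_one]

theorem partialForm_apply_of_constant (D : Fin n → Derivation K A A) {k : ℕ} (i : Fin n)
    (α : Form A n k) (v : Fin k → Fin n → A) (hv : ∀ s j, D i (v s j) = 0) :
    partialForm D i α v = D i (α v) := by
  change D i (α v) - ∑ s, α (Function.update v s (coeffPartial D i (v s))) = D i (α v)
  rw [Finset.sum_eq_zero, sub_zero]
  intro s _
  have : coeffPartial D i (v s) = 0 := funext fun j => hv s j
  rw [this]
  exact α.map_coord_zero s (by simp)

theorem derivation_stdFrame (δ : Derivation K A A) (s j : Fin n) : δ (stdFrame A n s j) = 0 := by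
  rw [stdFrame, Pi.single_apply]
  split_ifs <;> simp

theorem dfp_apply_stdFrame {m : ℕ} (D : Fin (m + 1) → Derivation K A A) (f : A)
    (α : Form A (m + 1) m) :
    dfp D f (((m + 1 : ℕ) : ℤ) - 2) m α (stdFrame A (m + 1)) =
      twistedDiv D f fun s => (-1) ^ (s : ℕ) * α (s.removeNth (stdFrame A (m + 1))) := by
  have h₁ : extD D α (stdFrame A (m + 1)) =
      ∑ s : Fin (m + 1), D s ((-1) ^ (s : ℕ) * α (s.removeNth (stdFrame A (m + 1)))) := by
    rw [extD_apply]
    refine Finset.sum_congr rfl fun s _ => ?_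
    rw [Finset.sum_eq_single s]
    · rw [partialForm_apply_of_constant D s α (s.removeNth (stdFrame A (m + 1))) fun t j => derivation_stdFrame (D s) (s.succAbove t) j]
      have : D s ((-1) ^ (s : ℕ)) = 0 := by
        rcases neg_one_pow_eq_or A (s : ℕ) with h | h <;> rw [h] <;> simp
      rw [Derivation.leibniz, this, smul_zero, add_zero, stdFrame, Pi.single_eq_same, one_smul,
        zsmul_eq_mul, smul_eq_mul]
      push_cast
      rfl
    · intro i _ hi
      rw [stdFrame, Pi.single_eq_of_ne hi, zero_smul]
    · simp
  have h₂ : dWedge D f α (stdFrame A (m + 1)) =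
      ∑ s : Fin (m + 1), (-1) ^ (s : ℕ) * α (s.removeNth (stdFrame A (m + 1))) * D s f := by
    rw [dWedge_apply]
    refine Finset.sum_congr rfl fun s _ => ?_
    rw [Finset.sum_eq_single s]
    · rw [stdFrame, Pi.single_eq_same, mul_one, zsmul_eq_mul]
      push_cast
      change (-1) ^ (s : ℕ) * (D s f * _) = (-1) ^ (s : ℕ) * _ * D s f
      ring
    · intro i _ hi
      rw [stdFrame, Pi.single_eq_of_ne hi, mul_zero]
    · simp
  -- For `k = n - 1` and `p = n - 2` the factor `k - p` is `1`, so the operator is `f dβ - df ∧ β`.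
  have h₃ : (m : ℤ) - (((m + 1 : ℕ) : ℤ) - 2) = 1 := by push_cast; ring
  change (f • extD D α - ((m : ℤ) - (((m + 1 : ℕ) : ℤ) - 2)) • dWedge D f α) (stdFrame A (m + 1)) =
    twistedDiv D f fun s => (-1) ^ (s : ℕ) * α (s.removeNth (stdFrame A (m + 1)))
  rw [h₃, one_smul, AlternatingMap.sub_apply, AlternatingMap.smul_apply, h₁, h₂, twistedDiv_apply,
    smul_eq_mul]

theorem mem_coboundaries_iff (hn : 0 < n) (D : Fin n → Derivation K A A) (f : A)
    (α : Form A n n) :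
    α ∈ coboundaries D f ((n : ℤ) - 2) n ↔
      α (stdFrame A n) ∈ LinearMap.range (twistedDiv D f) := by
  obtain ⟨m, rfl⟩ : ∃ m, n = m + 1 := ⟨n - 1, by omega⟩
  constructor
  · rintro ⟨β, rfl⟩
    exact ⟨_, (dfp_apply_stdFrame D f β).symm⟩
  · rintro ⟨X, hX⟩
    refine ⟨contract X (Pi.basisFun A (Fin (m + 1))).det, form_ext_stdFrame ?_⟩
    rw [dfp_apply_stdFrame, ← hX]
    congr 1
    funext s
    rw [contract_removeNth_stdFrame, det_stdFrame, mul_one, ← mul_assoc, ← mul_pow]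
    simp

theorem lieOneForm_stdFrame (D : Fin n → Derivation K A A) (X : Fin n → A) (s : Fin n) :
    lieOneForm D X (stdFrame A n s) = fun j => D j (X s) := by
  funext j
  rw [lieOneForm_apply, derivation_stdFrame, zero_add, Finset.sum_eq_single s]
  · rw [stdFrame, Pi.single_eq_same, one_mul]
  · intro i _ hi
    rw [stdFrame, Pi.single_eq_of_ne hi, zero_mul]
  · simp

/-- On the frame `L_X dxₛ = dXₛ`, so the subtracted sum is the coefficient of `Λ` times `div X`. -/
theorem bracketWith_apply_stdFrame (D : Fin n → Derivation K A A) (Λ : MultiVector A n n)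
    (X : Fin n → A) :
    bracketWith D Λ X (stdFrame A n) = -twistedDiv D (Λ (stdFrame A n)) X := by
  change vf D X (Λ (stdFrame A n)) - ∑ s, Λ (Function.update (stdFrame A n) s
    (lieOneForm D X (stdFrame A n s))) = _
  rw [vf_apply, twistedDiv_apply, neg_sub, Finset.mul_sum]
  congr 1
  refine Finset.sum_congr rfl fun s _ => ?_
  rw [form_update_stdFrame, lieOneForm_stdFrame, mul_comm]

theorem map_range_bracketWith (D : Fin n → Derivation K A A) (Λ : MultiVector A n n) :
    (LinearMap.range (bracketWith D Λ)).map (topFormEquiv K A n : Form A n n →ₗ[K] A) =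
      LinearMap.range (twistedDiv D (Λ (stdFrame A n))) := by
  ext a
  constructor
  · rintro ⟨_, ⟨X, rfl⟩, rfl⟩
    refine ⟨-X, ?_⟩
    rw [map_neg]
    exact (bracketWith_apply_stdFrame D Λ X).symm
  · rintro ⟨X, rfl⟩
    refine ⟨_, ⟨-X, rfl⟩, ?_⟩
    change bracketWith D Λ (-X) (stdFrame A n) = _
    rw [bracketWith_apply_stdFrame, map_neg, neg_neg]

/-- `H²_Λ` in terms of coefficients. -/
noncomputable def H2Equiv (D : Fin n → Derivation K A A) (Λ : MultiVector A n n) :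
    H2 D Λ ≃ₗ[K] A ⧸ LinearMap.range (twistedDiv D (Λ (stdFrame A n))) :=
  Submodule.Quotient.equiv _ _ (topFormEquiv K A n) (map_range_bracketWith D Λ)

end TopDegree

/-! ### First-order deformations over the dual numbers -/

section Deformations

theorem multilinearMap_map_add_smul {R ι M N : Type*} [CommRing R] [Fintype ι] [DecidableEq ι]
    [AddCommGroup M] [Module R M] [AddCommGroup N] [Module R N]
    (P : MultilinearMap R (fun _ : ι => M) N) {ε : R} (hε : ε * ε = 0) (v z : ι → M) :
    P (v + ε • z) = P v + ε • ∑ s, P (Function.update v s (z s)) := by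
  rw [P.map_add_eq_map_add_linearDeriv_add, P.linearDeriv_apply, Finset.smul_sum,
    Finset.sum_eq_zero (s := Finset.filter _ _), add_zero]
  · congr 1
    refine Finset.sum_congr rfl fun s _ => ?_
    rw [Pi.smul_apply, P.map_update_smul]
  · intro s hs
    -- The Taylor term that perturbs the arguments in `s` carries `ε ^ s.card`, which vanishes from
    -- two arguments on.
    have hs' : 2 ≤ s.card := (Finset.mem_filter.1 hs).2
    have := P.map_piecewise_smul (fun _ => ε) (s.piecewise z v) s
    have h₂ : s.piecewise (fun i => ε • s.piecewise z v i) (s.piecewise z v) =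
        s.piecewise (ε • z) v := by
      funext i
      by_cases hi : i ∈ s <;> simp [hi]
    rw [h₂] at this
    obtain ⟨k, hk⟩ := Nat.exists_eq_add_of_le hs'
    rw [this, Finset.prod_const, hk, pow_add, pow_two, hε, zero_mul, zero_smul]

variable {K A : Type*} [CommRing K] [CommRing A] [Algebra K A] {n : ℕ}

open TrivSqZeroExt in
theorem multiVector_dual_inl (P : MultiVector (DualNumber A) n n) (u : Fin n → Fin n → A) :
    P (fun s i => inl (u s i)) = inl (constPart P u) + inr (epsPart P u) :=
  (inl_fst_add_inr_snd_eq _).symm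

open TrivSqZeroExt in
theorem multiVector_dual_apply (P : MultiVector (DualNumber A) n n) (u y : Fin n → Fin n → A) :
    P (fun s i => inl (u s i) + inr (y s i)) =
      inl (constPart P u) +
        inr (epsPart P u + ∑ s, constPart P (Function.update u s (y s))) := by
  have h₁ : (fun s i => inl (u s i) + inr (y s i) : Fin n → Fin n → DualNumber A) =
      (fun s i => inl (u s i)) + (DualNumber.eps : DualNumber A) • fun s i => inl (y s i) := by
    funext s i
    ext <;> simp
  have h₂ := multilinearMap_map_add_smul P.toMultilinearMap
    (ε := (DualNumber.eps : DualNumber A)) DualNumber.eps_mul_eps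
    (fun s i => inl (u s i)) (fun s i => inl (y s i))
  rw [h₁]
  refine h₂.trans ?_
  have h₃ : ∀ s, P (Function.update (fun s i => inl (u s i)) s fun i => inl (y s i)) =
      inl (constPart P (Function.update u s (y s))) +
        inr (epsPart P (Function.update u s (y s))) := by
    intro s
    rw [← multiVector_dual_inl]
    congr 1
    funext t i
    by_cases ht : t = s
    · subst ht
      simp
    · simp [Function.update_of_ne ht]
  have h₄ := multiVector_dual_inl P u
  simp only [AlternatingMap.coe_multilinearMap] at h₂ ⊢
  rw [h₄, Finset.sum_congr rfl fun s _ => h₃ s]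
  ext
  · simp
  · simp [fst_sum]

theorem nambuBracket_dual (D : Fin n → Derivation K A A) (P : MultiVector (DualNumber A) n n)
    (g : Fin n → DualNumber A) :
    nambuBracket (fun i => dualDerivation (D i)) P g =
      TrivSqZeroExt.inl (constPart P fun s i => D i (g s).fst) +
        TrivSqZeroExt.inr (epsPart P (fun s i => D i (g s).fst) +
          ∑ s, constPart P (Function.update (fun s i => D i (g s).fst) s
            fun i => D i (g s).snd)) :=
  multiVector_dual_apply P (fun s i => D i (g s).fst) (fun s i => D i (g s).snd)

/-- The `ε⁰`-parts agree because both reduce to `Λ`. In the `ε¹`-parts the terms containing `(g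
s).snd` occur on both sides and cancel. -/
theorem infFlow_nambuBracket_eq_iff (D : Fin n → Derivation K A A) {Λ : MultiVector A n n}
    (P P' : InfDeformation Λ) (X : Fin n → A) (g : Fin n → DualNumber A) :
    infFlow D X (nambuBracket (fun i => dualDerivation (D i)) P.1 g) =
        nambuBracket (fun i => dualDerivation (D i)) P'.1 (fun s => infFlow D X (g s)) ↔
      vf D X (Λ fun s i => D i (g s).fst) - ∑ s, Λ (Function.update (fun s i => D i (g s).fst) s
          fun i => D i (vf D X (g s).fst)) =
        (epsPart P'.1 - epsPart P.1) fun s i => D i (g s).fst := by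
  have hfst : ∀ s, (infFlow D X (g s)).fst = (g s).fst := fun s => by simp [infFlow]
  have hsnd : ∀ s, (infFlow D X (g s)).snd = (g s).snd + vf D X (g s).fst := fun s => by
    simp [infFlow]
  rw [nambuBracket_dual, nambuBracket_dual, P.2, P'.2]
  simp only [hfst, hsnd, map_add]
  have hsum : ∑ s, Λ (Function.update (fun s i => D i (g s).fst) s
        fun i => D i (g s).snd + D i (vf D X (g s).fst)) =
      ∑ s, Λ (Function.update (fun s i => D i (g s).fst) s fun i => D i (g s).snd) +
        ∑ s, Λ (Function.update (fun s i => D i (g s).fst) s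
          fun i => D i (vf D X (g s).fst)) := by
    rw [← Finset.sum_add_distrib]
    exact Finset.sum_congr rfl fun s _ => Λ.map_update_add _ _ _ _
  rw [hsum, AlternatingMap.sub_apply, TrivSqZeroExt.ext_iff]
  simp only [infFlow, TrivSqZeroExt.fst_add, TrivSqZeroExt.fst_inl, TrivSqZeroExt.fst_inr,
    TrivSqZeroExt.snd_add, TrivSqZeroExt.snd_inl, TrivSqZeroExt.snd_inr, add_zero, zero_add,
    true_and]
  constructor
  · intro h
    linear_combination h
  · intro h
    linear_combination h

/-- `L_X dφ = d(X.φ)`; it identifies the change of the bracket of functions with the Schouten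
bracket evaluated on differentials. -/
theorem lieOneForm_differential {D : Fin n → Derivation K A A}
    (hcomm : ∀ i j φ, D i (D j φ) = D j (D i φ)) (X : Fin n → A) (φ : A) :
    lieOneForm D X (fun i => D i φ) = fun i => D i (vf D X φ) := by
  funext j
  simp only [lieOneForm_apply, vf_apply, map_sum, Derivation.leibniz, smul_eq_mul,
    Finset.sum_add_distrib, hcomm j]

theorem equivalent_iff {D : Fin n → Derivation K A A} {x : Fin n → A}
    (hx : ∀ i j, D i (x j) = Pi.single (M := fun _ => A) i 1 j)
    (hcomm : ∀ i j φ, D i (D j φ) = D j (D i φ)) {Λ : MultiVector A n n}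
    (P P' : InfDeformation Λ) :
    InfDeformation.Equivalent D P P' ↔
      ∃ X, bracketWith D Λ X = epsPart P'.1 - epsPart P.1 := by
  refine exists_congr fun X => ?_
  simp only [infFlow_nambuBracket_eq_iff, ← lieOneForm_differential hcomm]
  constructor
  · intro h
    have hframe : (fun s i => D i (x s)) = stdFrame A n := by
      funext s i
      rw [hx, stdFrame, Pi.single_apply, Pi.single_apply]
      simp only [eq_comm]
    -- Coordinate functions suffice: their differentials are the frame, which determines an
    -- `n`-vector.
    have := h fun s => TrivSqZeroExt.inl (x s)
    simp only [TrivSqZeroExt.fst_inl] at this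
    refine form_ext_stdFrame ?_
    rw [← hframe, ← this]
    rfl
  · intro h g
    rw [← h]
    rfl

theorem H2_mk_eq_iff_equivalent {D : Fin n → Derivation K A A} {x : Fin n → A}
    (hx : ∀ i j, D i (x j) = Pi.single (M := fun _ => A) i 1 j)
    (hcomm : ∀ i j φ, D i (D j φ) = D j (D i φ)) {Λ : MultiVector A n n}
    (P P' : InfDeformation Λ) :
    H2.mk D Λ (epsPart P.1) = H2.mk D Λ (epsPart P'.1) ↔ InfDeformation.Equivalent D P P' := by
  rw [equivalent_iff hx hcomm, eq_comm]
  exact Submodule.Quotient.eq _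

open TrivSqZeroExt in
theorem surjective_epsPart (Λ : MultiVector A n n) :
    Function.Surjective fun P : InfDeformation Λ => epsPart P.1 := by
  intro Q
  set P : MultiVector (DualNumber A) n n :=
    (inl (Λ (stdFrame A n)) + inr (Q (stdFrame A n)) : DualNumber A) •
      (Pi.basisFun (DualNumber A) (Fin n)).det with hP
  have hframe : (fun s i => inl (stdFrame A n s i)) = stdFrame (DualNumber A) n := by
    funext s i
    by_cases h : i = s
    · subst h
      simp [stdFrame]
    · simp [stdFrame, h]
  have h := multiVector_dual_inl P (stdFrame A n)
  rw [hframe, hP, AlternatingMap.smul_apply, det_stdFrame, smul_eq_mul, mul_one, ← hP] at h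
  refine ⟨⟨P, form_ext_stdFrame ?_⟩, form_ext_stdFrame ?_⟩
  · simpa using (congrArg fst h).symm
  · simpa using (congrArg snd h).symm

end Deformations

/-! ### Formal power series -/

section Formal

variable {K : Type*} [Field K] {n : ℕ}

open MvPowerSeries in
theorem coeff_natCast_mul_X_mul_pderiv (c : ℕ) (i : Fin n) (φ : MvPowerSeries (Fin n) K)
    (m : Fin n →₀ ℕ) :
    coeff m ((c : MvPowerSeries (Fin n) K) * X i * pderiv K i φ) = c * m i * coeff m φ := by
  rw [← map_natCast (C : K →+* MvPowerSeries (Fin n) K), mul_assoc, coeff_C_mul]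
  by_cases hi : m i = 0
  · rw [hi, X_def, coeff_monomial_mul, if_neg]
    · simp
    · rw [Finsupp.single_le_iff]
      omega
  · have hle : Finsupp.single i 1 ≤ m := by
      rw [Finsupp.single_le_iff]
      omega
    rw [X_def, coeff_monomial_mul, if_pos hle, coeff_pderiv, tsub_add_cancel_of_le hle]
    have : (((m - Finsupp.single i 1 : Fin n →₀ ℕ) i : ℕ) : K) + 1 = m i := by
      have h1 := hle i
      rw [Finsupp.single_eq_same] at h1
      rw [Finsupp.tsub_apply, Finsupp.single_eq_same]
      push_cast [h1]
      ring
    rw [this]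
    ring

open MvPowerSeries in
theorem isLocalCalculus_mvPowerSeries [CharZero K] :
    IsLocalCalculus (K := K) (A := MvPowerSeries (Fin n) K) (fun i => pderiv K i) X where
  partial_coord i j := by
    rw [pderiv_X]
  hadamard := by
    refine ⟨AlgHom.mk (constantCoeff : MvPowerSeries (Fin n) K →+* K) ?_, ?_, ?_⟩
    · intro c
      simp [MvPowerSeries.algebraMap_apply]
    · intro i
      simp
    · intro φ
      -- The radial field multiplies the coefficient at `m` by its degree, so one divides by it. At
      -- `m = 0` the quotient is `0` by convention, and the constant term is carried separately.
      let h : MvPowerSeries (Fin n) K := fun m => coeff m φ / m.degree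
      refine ⟨fun i => pderiv K i h, ?_⟩
      ext m
      have h₁ : ∀ i, coeff m (X i * pderiv K i h) = m i * coeff m h := by
        intro i
        simpa using coeff_natCast_mul_X_mul_pderiv 1 i h m
      rw [map_add, map_sum, Finset.sum_congr rfl fun i _ => h₁ i, ← Finset.sum_mul]
      change _ = coeff m (C (constantCoeff φ)) + _
      rw [coeff_C]
      have h₂ : (∑ i, (m i : K)) = m.degree := by
        rw [Finsupp.degree_eq_sum]
        push_cast
        rfl
      have h₃ : coeff m h = coeff m φ / m.degree := rfl
      rw [h₂, h₃]
      split_ifs with hm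
      · simp [hm]
      · have : (m.degree : K) ≠ 0 := by
          rw [Nat.cast_ne_zero, ne_eq, Finsupp.degree_eq_zero_iff]
          exact hm
        field_simp
        ring
  exists_euler_add w hw a φ := by
    -- `E + (a + 1)` is diagonal on monomials; its eigenvalues are positive integers, hence
    -- invertible.
    refine ⟨fun m => coeff m φ / (∑ i, (w i : K) * m i + (a + 1)), ?_⟩
    set h : MvPowerSeries (Fin n) K := fun m => coeff m φ / (∑ i, (w i : K) * m i + (a + 1))
      with hh
    ext m
    have h₁ : coeff m ((a + 1 : MvPowerSeries (Fin n) K) * h) = (a + 1) * coeff m h := by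
      rw [← coeff_C_mul]
      simp
    rw [map_add, map_sum, Finset.sum_congr rfl fun i _ => coeff_natCast_mul_X_mul_pderiv (w i) i h m,
      ← Finset.sum_mul, h₁, ← add_mul]
    have h₂ : coeff m h = coeff m φ / (∑ i, (w i : K) * m i + (a + 1)) := rfl
    have h₃ : (∑ i, (w i : K) * m i + (a + 1)) ≠ 0 := by
      have : (∑ i, (w i : K) * m i + (a + 1)) = ((∑ i, w i * m i + (a + 1) : ℕ) : K) := by
        push_cast
        rfl
      rw [this, Nat.cast_ne_zero]
      omega
    rw [h₂, mul_div_cancel₀ _ h₃]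

open MvPowerSeries in
theorem mvPowerSeries_pderiv_comm (i j : Fin n) (φ : MvPowerSeries (Fin n) K) :
    pderiv K i (pderiv K j φ) = pderiv K j (pderiv K i φ) := by
  ext m
  simp only [coeff_pderiv]
  rw [add_right_comm m]
  by_cases h : i = j
  · subst h
    rfl
  · simp [h, Ne.symm h]
    ring

end Formal

/-! ### Weighted averages of differentiable functions -/

section Averages

variable {𝕜 : Type*} [RCLike 𝕜] {n : ℕ}

/-- The quasihomogeneous scaling `(t^{w₁} x₁, …, t^{wₙ} xₙ)`. -/
noncomputable def scaleL (𝕜 : Type*) [RCLike 𝕜] {n : ℕ} (w : Fin n → ℕ) (t : ℝ) :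
    (Fin n → 𝕜) →L[𝕜] (Fin n → 𝕜) :=
  ContinuousLinearMap.pi fun i => (t : 𝕜) ^ w i • ContinuousLinearMap.proj i

theorem scaleL_apply (w : Fin n → ℕ) (t : ℝ) (x : Fin n → 𝕜) (i : Fin n) :
    scaleL 𝕜 w t x i = (t : 𝕜) ^ w i * x i := rfl

theorem norm_ofReal_pow_le_one {t : ℝ} (ht : t ∈ Set.Icc (0 : ℝ) 1) (k : ℕ) :
    ‖(t : 𝕜) ^ k‖ ≤ 1 := by
  rw [norm_pow, RCLike.norm_ofReal, abs_of_nonneg ht.1]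
  exact pow_le_one₀ ht.1 ht.2

theorem norm_scaleL_apply_le (w : Fin n → ℕ) {t : ℝ} (ht : t ∈ Set.Icc (0 : ℝ) 1)
    (x : Fin n → 𝕜) : ‖scaleL 𝕜 w t x‖ ≤ ‖x‖ := by
  refine (pi_norm_le_iff_of_nonneg (norm_nonneg x)).2 fun i => ?_
  rw [scaleL_apply, norm_mul]
  exact (mul_le_of_le_one_left (norm_nonneg _) (norm_ofReal_pow_le_one ht _)).trans
    (norm_le_pi_norm x i)

theorem norm_scaleL_le (w : Fin n → ℕ) {t : ℝ} (ht : t ∈ Set.Icc (0 : ℝ) 1) :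
    ‖scaleL 𝕜 w t‖ ≤ 1 :=
  ContinuousLinearMap.opNorm_le_bound _ zero_le_one fun x => by
    rw [one_mul]
    exact norm_scaleL_apply_le w ht x

theorem continuous_scaleL_apply (w : Fin n → ℕ) (x : Fin n → 𝕜) :
    Continuous fun t => scaleL 𝕜 w t x := by
  refine continuous_pi fun i => ?_
  simp only [scaleL_apply]
  fun_prop

theorem continuous_scaleL (w : Fin n → ℕ) : Continuous fun t => scaleL 𝕜 w t := by
  have : (fun t => scaleL 𝕜 w t) = fun t : ℝ => ∑ i, (t : 𝕜) ^ w i •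
      (ContinuousLinearMap.pi fun j => if j = i then ContinuousLinearMap.proj i else 0 :
        (Fin n → 𝕜) →L[𝕜] (Fin n → 𝕜)) := by
    funext t
    ext x j
    simp [scaleL, Finset.sum_apply, ite_apply, apply_ite]
  rw [this]
  fun_prop

theorem scaleL_mem_ball (w : Fin n → ℕ) {t : ℝ} (ht : t ∈ Set.Icc (0 : ℝ) 1) {r : ℝ}
    {x : Fin n → 𝕜} (hx : x ∈ Metric.ball 0 r) : scaleL 𝕜 w t x ∈ Metric.ball 0 r := by
  rw [mem_ball_zero_iff] at hx ⊢
  exact (norm_scaleL_apply_le w ht x).trans_lt hx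

/-- The weighted average `x ↦ ∫₀¹ t^a φ(t^{w₁} x₁, …, t^{wₙ} xₙ) dt`. -/
noncomputable def avg (w : Fin n → ℕ) (a : ℕ) (φ : (Fin n → 𝕜) → 𝕜) (x : Fin n → 𝕜) : 𝕜 :=
  ∫ t in (0 : ℝ)..1, (t : 𝕜) ^ a * φ (scaleL 𝕜 w t x)

/-- The `i`-th partial derivative of a function. -/
noncomputable def fpart (i : Fin n) (φ : (Fin n → 𝕜) → 𝕜) (x : Fin n → 𝕜) : 𝕜 :=
  fderiv 𝕜 φ x (Pi.single i 1)

theorem fderiv_eq_sum_fpart (φ : (Fin n → 𝕜) → 𝕜) (x : Fin n → 𝕜) :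
    fderiv 𝕜 φ x = ∑ i, fpart i φ x • (ContinuousLinearMap.proj i : (Fin n → 𝕜) →L[𝕜] 𝕜) := by
  ext v
  conv_lhs => rw [pi_eq_sum_univ' v, map_sum]
  simp only [_root_.sum_apply, _root_.smul_apply,
    ContinuousLinearMap.proj_apply, smul_eq_mul, fpart, map_smul]
  exact Finset.sum_congr rfl fun i _ => mul_comm _ _

theorem uIoc_zero_one_subset : Set.uIoc (0 : ℝ) 1 ⊆ Set.Icc 0 1 := by
  rw [Set.uIoc_of_le zero_le_one]
  exact Set.Ioc_subset_Icc_self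

theorem continuousOn_integrand (w : Fin n → ℕ) (a : ℕ) {φ : (Fin n → 𝕜) → 𝕜} {r : ℝ}
    (hφ : ContinuousOn φ (Metric.ball 0 r)) {x : Fin n → 𝕜} (hx : x ∈ Metric.ball 0 r) :
    ContinuousOn (fun t : ℝ => (t : 𝕜) ^ a * φ (scaleL 𝕜 w t x)) (Set.Icc 0 1) := by
  refine ContinuousOn.mul (by fun_prop) ?_
  exact hφ.comp (continuous_scaleL_apply w x).continuousOn fun t ht => scaleL_mem_ball w ht hx

theorem intervalIntegrable_integrand (w : Fin n → ℕ) (a : ℕ) {φ : (Fin n → 𝕜) → 𝕜} {r : ℝ}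
    (hφ : ContinuousOn φ (Metric.ball 0 r)) {x : Fin n → 𝕜} (hx : x ∈ Metric.ball 0 r) :
    IntervalIntegrable (fun t : ℝ => (t : 𝕜) ^ a * φ (scaleL 𝕜 w t x)) MeasureTheory.volume 0 1 := by
  refine ContinuousOn.intervalIntegrable ?_
  rw [Set.uIcc_of_le zero_le_one]
  exact continuousOn_integrand w a hφ hx

theorem continuousOn_of_contDiffAt {m : ℕ∞ω} {φ : (Fin n → 𝕜) → 𝕜} {s : Set (Fin n → 𝕜)}
    (hφ : ∀ x ∈ s, ContDiffAt 𝕜 m φ x) : ContinuousOn φ s :=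
  fun x hx => (hφ x hx).continuousAt.continuousWithinAt

theorem contDiffAt_fpart {m : ℕ∞ω} (hm : m + 1 ≤ m) (i : Fin n) {φ : (Fin n → 𝕜) → 𝕜}
    {x : Fin n → 𝕜} (hφ : ContDiffAt 𝕜 m φ x) : ContDiffAt 𝕜 m (fpart i φ) x :=
  (hφ.fderiv_right hm).clm_apply contDiffAt_const

theorem continuousOn_fpart (i : Fin n) {φ : (Fin n → 𝕜) → 𝕜} {r : ℝ}
    (hφ : ∀ x ∈ Metric.ball 0 r, ContDiffAt 𝕜 1 φ x) :
    ContinuousOn (fpart i φ) (Metric.ball 0 r) := by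
  refine continuousOn_of_contDiffAt (m := 0) fun x hx => ?_
  exact ((hφ x hx).fderiv_right (by simp)).clm_apply contDiffAt_const

/-- Differentiation under the integral; the scaling contributes `t ^ w i`, so a partial derivative
of an average is again an average, with exponent `a + w i`. -/
theorem hasFDerivAt_avg (w : Fin n → ℕ) (a : ℕ) {φ : (Fin n → 𝕜) → 𝕜} {r : ℝ}
    (hφ : ∀ x ∈ Metric.ball 0 r, ContDiffAt 𝕜 1 φ x) {x : Fin n → 𝕜} (hx : x ∈ Metric.ball 0 r) :
    HasFDerivAt (avg w a φ) (∑ i, avg w (a + w i) (fpart i φ) x •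
      (ContinuousLinearMap.proj i : (Fin n → 𝕜) →L[𝕜] 𝕜)) x := by
  -- A smaller closed ball is compact and stable under the scalings, so it gives bounds on the
  -- partials uniform in `t`.
  obtain ⟨ρ, hxρ, hρr⟩ := exists_between (mem_ball_zero_iff.1 hx)
  have hsub : Metric.closedBall (0 : Fin n → 𝕜) ρ ⊆ Metric.ball 0 r :=
    Metric.closedBall_subset_ball hρr
  have hbd : ∀ i, ∃ C, ∀ y ∈ Metric.closedBall (0 : Fin n → 𝕜) ρ, ‖fpart i φ y‖ ≤ C := fun i =>
    (isCompact_closedBall _ _).exists_bound_of_continuousOn ((continuousOn_fpart i hφ).mono hsub)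
  choose C hC using hbd
  have hcont := continuousOn_of_contDiffAt hφ
  have hmeas : ∀ y ∈ Metric.ball (0 : Fin n → 𝕜) r, ∀ (b : ℕ) (ψ : (Fin n → 𝕜) → 𝕜),
      ContinuousOn ψ (Metric.ball 0 r) → MeasureTheory.AEStronglyMeasurable
        (fun t : ℝ => (t : 𝕜) ^ b * ψ (scaleL 𝕜 w t y))
        (MeasureTheory.volume.restrict (Set.uIoc (0 : ℝ) 1)) := fun y hy b ψ hψ =>
    ((continuousOn_integrand w b hψ hy).mono uIoc_zero_one_subset).aestronglyMeasurable
      measurableSet_uIoc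
  have key := intervalIntegral.hasFDerivAt_integral_of_dominated_of_fderiv_le (𝕜 := 𝕜)
    (μ := MeasureTheory.volume) (a := 0) (b := 1) (s := Metric.ball (0 : Fin n → 𝕜) ρ)
    (F := fun y t => (t : 𝕜) ^ a * φ (scaleL 𝕜 w t y))
    (F' := fun y t => ∑ i, ((t : 𝕜) ^ (a + w i) * fpart i φ (scaleL 𝕜 w t y)) •
      (ContinuousLinearMap.proj i : (Fin n → 𝕜) →L[𝕜] 𝕜))
    (bound := fun _ => ∑ i, C i * ‖(ContinuousLinearMap.proj i : (Fin n → 𝕜) →L[𝕜] 𝕜)‖)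
    (x₀ := x) (Metric.isOpen_ball.mem_nhds (mem_ball_zero_iff.2 hxρ))
    (by
      filter_upwards [Metric.isOpen_ball.mem_nhds hx] with y hy
      exact hmeas y hy a φ hcont)
    (intervalIntegrable_integrand w a hcont hx)
    (by
      refine Finset.aestronglyMeasurable_fun_sum _ fun i _ => ?_
      exact (hmeas x hx _ _ (continuousOn_fpart i hφ)).smul_const _)
    (by
      refine Eventually.of_forall fun t ht y hy => ?_
      have ht' := uIoc_zero_one_subset ht
      refine (norm_sum_le _ _).trans (Finset.sum_le_sum fun i _ => ?_)
      rw [norm_smul, norm_mul]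
      refine mul_le_mul_of_nonneg_right ?_ (norm_nonneg _)
      refine (mul_le_of_le_one_left (norm_nonneg _) (norm_ofReal_pow_le_one ht' _)).trans ?_
      exact hC i _ (Metric.ball_subset_closedBall (scaleL_mem_ball w ht' hy)))
    intervalIntegrable_const
    (by
      refine Eventually.of_forall fun t ht y hy => ?_
      have ht' := uIoc_zero_one_subset ht
      have hy' : scaleL 𝕜 w t y ∈ Metric.ball (0 : Fin n → 𝕜) r :=
        scaleL_mem_ball w ht' (Metric.ball_subset_ball hρr.le hy)
      have h₁ := ((hφ _ hy').differentiableAt one_ne_zero).hasFDerivAt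
      have h₂ := (h₁.comp y (scaleL 𝕜 w t).hasFDerivAt).const_mul ((t : 𝕜) ^ a)
      refine h₂.congr_fderiv ?_
      rw [fderiv_eq_sum_fpart]
      ext v
      simp only [_root_.sum_apply, _root_.smul_apply,
        ContinuousLinearMap.comp_apply, ContinuousLinearMap.proj_apply, smul_eq_mul,
        scaleL_apply, Finset.mul_sum]
      refine Finset.sum_congr rfl fun i _ => ?_
      rw [pow_add]
      ring)
  refine HasFDerivAt.congr_fderiv key ?_
  rw [intervalIntegral.integral_finsetSum]
  · refine Finset.sum_congr rfl fun i _ => ?_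
    rw [intervalIntegral.integral_smul_const]
    rfl
  · intro i _
    have h := intervalIntegrable_integrand w (a + w i) (continuousOn_fpart i hφ) hx
    rw [intervalIntegrable_iff] at h ⊢
    exact h.smul_const _

theorem fpart_avg (w : Fin n → ℕ) (a : ℕ) {φ : (Fin n → 𝕜) → 𝕜} {r : ℝ}
    (hφ : ∀ x ∈ Metric.ball 0 r, ContDiffAt 𝕜 1 φ x) {x : Fin n → 𝕜} (hx : x ∈ Metric.ball 0 r)
    (i : Fin n) : fpart i (avg w a φ) x = avg w (a + w i) (fpart i φ) x := by
  rw [fpart, (hasFDerivAt_avg w a hφ hx).fderiv]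
  simp [Pi.single_apply]

/-- Induction on `k`, for all exponents `a` and all smooth `φ` at once, since differentiating
changes both. -/
theorem contDiffAt_avg (w : Fin n → ℕ) {r : ℝ} (k : ℕ) :
    ∀ (a : ℕ) {φ : (Fin n → 𝕜) → 𝕜}, (∀ x ∈ Metric.ball 0 r, ContDiffAt 𝕜 ∞ φ x) →
      ∀ x ∈ Metric.ball 0 r, ContDiffAt 𝕜 k (avg w a φ) x := by
  have h1 : (1 : ℕ∞ω) ≤ ∞ := by exact_mod_cast le_top
  induction k with
  | zero =>
    intro a φ hφ x hx
    refine contDiffAt_zero.2 ⟨Metric.ball 0 r, Metric.isOpen_ball.mem_nhds hx, fun y hy => ?_⟩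
    exact (hasFDerivAt_avg w a (fun x hx => (hφ x hx).of_le h1) hy).continuousAt.continuousWithinAt
  | succ k ih =>
    intro a φ hφ x hx
    rw [Nat.cast_add, Nat.cast_one, contDiffAt_succ_iff_hasFDerivAt]
    refine ⟨_, ⟨Metric.ball 0 r, Metric.isOpen_ball.mem_nhds hx, fun y hy =>
      hasFDerivAt_avg w a (fun x hx => (hφ x hx).of_le h1) hy⟩, ?_⟩
    refine ContDiffAt.sum fun i _ => ?_
    exact (ih _ (fun x hx => contDiffAt_fpart le_rfl i (hφ x hx)) x hx).smul contDiffAt_const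

theorem eventually_contDiffAt_infty_avg (w : Fin n → ℕ) (a : ℕ) {φ : (Fin n → 𝕜) → 𝕜}
    (hφ : ∀ᶠ x in 𝓝 0, ContDiffAt 𝕜 ∞ φ x) : ∀ᶠ x in 𝓝 0, ContDiffAt 𝕜 ∞ (avg w a φ) x := by
  obtain ⟨r, hr, hball⟩ := Metric.eventually_nhds_iff_ball.1 hφ
  filter_upwards [Metric.ball_mem_nhds 0 hr] with x hx
  exact contDiffAt_infty.2 fun k => contDiffAt_avg w k a hball x hx

theorem hasDerivAt_rclike_ofReal (t : ℝ) : HasDerivAt (fun t : ℝ => (t : 𝕜)) 1 t :=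
  (RCLike.ofRealCLM (K := 𝕜)).hasDerivAt.congr_deriv (by simp)

/-- The derivative of `φ` along the scaling orbits. -/
theorem hasDerivAt_scaleL (w : Fin n → ℕ) {φ : (Fin n → 𝕜) → 𝕜} {r : ℝ}
    (hφ : ∀ x ∈ Metric.ball 0 r, ContDiffAt 𝕜 1 φ x) {x : Fin n → 𝕜} (hx : x ∈ Metric.ball 0 r)
    {t : ℝ} (ht : t ∈ Set.Icc (0 : ℝ) 1) :
    HasDerivAt (fun t : ℝ => φ (scaleL 𝕜 w t x))
      (∑ i, fpart i φ (scaleL 𝕜 w t x) * (w i * (t : 𝕜) ^ (w i - 1) * x i)) t := by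
  have h₁ := ((hφ _ (scaleL_mem_ball w ht hx)).differentiableAt one_ne_zero).hasFDerivAt
  have h₂ : HasDerivAt (fun t : ℝ => scaleL 𝕜 w t x)
      (fun i => w i * (t : 𝕜) ^ (w i - 1) * x i) t := by
    rw [hasDerivAt_pi]
    intro i
    simp only [scaleL_apply]
    have h₃ := hasDerivAt_rclike_ofReal (𝕜 := 𝕜) t
    simpa using (h₃.pow (w i)).mul_const (x i)
  have h₄ := (h₁.restrictScalars ℝ).comp_hasDerivAt t h₂
  refine h₄.congr_deriv ?_
  rw [ContinuousLinearMap.coe_restrictScalars', fderiv_eq_sum_fpart]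
  simp [_root_.sum_apply]

/-- Integrate the derivative of `t ^ (a + 1) φ(t^w x)` from `0` to `1`; the factor `t ^ (a + 1)`
kills the value at `0`. -/
theorem euler_avg {w : Fin n → ℕ} (hw : ∀ i, 0 < w i) (a : ℕ) {φ : (Fin n → 𝕜) → 𝕜} {r : ℝ}
    (hφ : ∀ x ∈ Metric.ball 0 r, ContDiffAt 𝕜 1 φ x) {x : Fin n → 𝕜} (hx : x ∈ Metric.ball 0 r) :
    ∑ i, (w i : 𝕜) * x i * fpart i (avg w a φ) x + (a + 1) * avg w a φ x = φ x := by
  have hcont := continuousOn_of_contDiffAt hφ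
  have hint : ∀ i, IntervalIntegrable (fun t : ℝ => (w i : 𝕜) * x i *
      ((t : 𝕜) ^ (a + w i) * fpart i φ (scaleL 𝕜 w t x))) MeasureTheory.volume 0 1 := fun i =>
    (intervalIntegrable_integrand w _ (continuousOn_fpart i hφ) hx).const_mul _
  have hint' : IntervalIntegrable (fun t : ℝ => (a + 1 : 𝕜) *
      ((t : 𝕜) ^ a * φ (scaleL 𝕜 w t x))) MeasureTheory.volume 0 1 :=
    (intervalIntegrable_integrand w _ hcont hx).const_mul _
  have hsum := IntervalIntegrable.sum Finset.univ fun i _ => hint i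
  have hder : ∀ t ∈ Set.uIcc (0 : ℝ) 1, HasDerivAt
      (fun t : ℝ => (t : 𝕜) ^ (a + 1) * φ (scaleL 𝕜 w t x))
      ((∑ i, fun t : ℝ => (w i : 𝕜) * x i *
        ((t : 𝕜) ^ (a + w i) * fpart i φ (scaleL 𝕜 w t x))) t +
        (a + 1) * ((t : 𝕜) ^ a * φ (scaleL 𝕜 w t x))) t := by
    intro t ht
    rw [Set.uIcc_of_le zero_le_one] at ht
    have h₃ := hasDerivAt_rclike_ofReal (𝕜 := 𝕜) t
    have h₄ := (h₃.pow (a + 1)).mul (hasDerivAt_scaleL w hφ hx ht)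
    refine h₄.congr_deriv ?_
    rw [add_comm, Finset.sum_apply]
    congr 1
    · rw [Pi.pow_apply, Finset.mul_sum]
      refine Finset.sum_congr rfl fun i _ => ?_
      have : (t : 𝕜) ^ (a + w i) = (t : 𝕜) ^ (a + 1) * (t : 𝕜) ^ (w i - 1) := by
        rw [← pow_add]
        congr 1
        have := hw i
        omega
      rw [this]
      ring
    · simp
      ring
  have key := intervalIntegral.integral_eq_sub_of_hasDerivAt hder (hsum.add hint')
  rw [intervalIntegral.integral_add hsum hint', intervalIntegral.integral_const_mul] at key
  simp only [Finset.sum_apply] at key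
  rw [intervalIntegral.integral_finsetSum fun i _ => hint i] at key
  have h₁ : scaleL 𝕜 w 1 x = x := by
    funext i
    simp [scaleL_apply]
  simp only [intervalIntegral.integral_const_mul, h₁, RCLike.ofReal_one, one_pow, one_mul,
    RCLike.ofReal_zero, zero_pow (Nat.succ_ne_zero a), zero_mul, sub_zero] at key
  rw [← key]
  congr 1
  exact Finset.sum_congr rfl fun i _ => by rw [fpart_avg w a hφ hx]; rfl

/-- The fundamental theorem of calculus along the segment from `0` to `x`, i.e. the scaling with all
weights `1`. -/
theorem hadamard_avg {φ : (Fin n → 𝕜) → 𝕜} {r : ℝ}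
    (hφ : ∀ x ∈ Metric.ball 0 r, ContDiffAt 𝕜 1 φ x) {x : Fin n → 𝕜} (hx : x ∈ Metric.ball 0 r) :
    φ x = φ 0 + ∑ i, x i * avg (fun _ => 1) 0 (fpart i φ) x := by
  have hint : ∀ i, IntervalIntegrable (fun t : ℝ => x i *
      ((t : 𝕜) ^ 0 * fpart i φ (scaleL 𝕜 (fun _ => 1) t x))) MeasureTheory.volume 0 1 := fun i =>
    (intervalIntegrable_integrand _ _ (continuousOn_fpart i hφ) hx).const_mul _
  have hsum := IntervalIntegrable.sum Finset.univ fun i _ => hint i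
  have key := intervalIntegral.integral_eq_sub_of_hasDerivAt
    (f := fun t : ℝ => φ (scaleL 𝕜 (fun _ => 1) t x)) (fun t ht => by
      rw [Set.uIcc_of_le zero_le_one] at ht
      refine (hasDerivAt_scaleL (fun _ => 1) hφ hx ht).congr_deriv ?_
      rw [Finset.sum_apply]
      refine Finset.sum_congr rfl fun i _ => ?_
      simp [mul_comm]) hsum
  simp only [Finset.sum_apply] at key
  rw [intervalIntegral.integral_finsetSum fun i _ => hint i] at key
  have h₁ : scaleL 𝕜 (fun _ => 1) 1 x = x := by
    funext i
    simp [scaleL_apply]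
  have h₀ : scaleL 𝕜 (fun _ => 1) 0 x = 0 := by
    funext i
    simp [scaleL_apply]
  simp only [intervalIntegral.integral_const_mul, h₁, h₀] at key
  rw [← sub_eq_iff_eq_add', ← key]
  rfl

end Averages

/-! ### Analyticity of the averages -/

section AnalyticAverages

variable {𝕜 : Type*} [RCLike 𝕜] {n : ℕ}

theorem analyticAt_avg (w : Fin n → ℕ) (a : ℕ) {φ : (Fin n → 𝕜) → 𝕜} (hφ : AnalyticAt 𝕜 φ 0) :
    AnalyticAt 𝕜 (avg w a φ) 0 := by
  obtain ⟨p, R, hp⟩ := hφ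
  obtain ⟨r, hr0, hrR⟩ := ENNReal.lt_iff_exists_nnreal_btwn.1 hp.r_pos
  have hrad : (r : ENNReal) < p.radius := hrR.trans_le hp.r_le
  have hsummable := p.summable_norm_mul_pow hrad
  let F : ∀ k : ℕ, ℝ → ContinuousMultilinearMap 𝕜 (fun _ : Fin k => Fin n → 𝕜) 𝕜 := fun k t =>
    (t : 𝕜) ^ a • (p k).compContinuousLinearMap fun _ => scaleL 𝕜 w t
  have hFcont : ∀ k, Continuous (F k) := by
    intro k
    have h₁ : Continuous fun t : ℝ =>
        (ContinuousMultilinearMap.compContinuousLinearMapContinuousMultilinear 𝕜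
          (fun _ : Fin k => Fin n → 𝕜) (fun _ : Fin k => Fin n → 𝕜) 𝕜) fun _ => scaleL 𝕜 w t :=
      (ContinuousMultilinearMap.cont _).comp (continuous_pi fun _ => continuous_scaleL w)
    have h₂ : Continuous fun t : ℝ => (t : 𝕜) ^ a := by fun_prop
    exact h₂.smul (h₁.clm_apply continuous_const)
  have hFnorm : ∀ k, ∀ t ∈ Set.uIoc (0 : ℝ) 1, ‖F k t‖ ≤ ‖p k‖ := by
    intro k t ht
    have ht' := uIoc_zero_one_subset ht
    rw [norm_smul]
    refine (mul_le_of_le_one_left (norm_nonneg _) (norm_ofReal_pow_le_one ht' _)).trans ?_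
    refine ((p k).norm_compContinuousLinearMap_le _).trans ?_
    exact mul_le_of_le_one_right (norm_nonneg _)
      (Finset.prod_le_one (fun _ _ => norm_nonneg _) fun _ _ => norm_scaleL_le w ht')
  -- Averaging the Taylor series term by term: the scalings have norm at most `1`, so `q` is
  -- dominated by `p`, and dominated convergence allows summing under the integral.
  let q : FormalMultilinearSeries 𝕜 (Fin n → 𝕜) 𝕜 := fun k => ∫ t in (0 : ℝ)..1, F k t
  have hqnorm : ∀ k, ‖q k‖ ≤ ‖p k‖ := by
    intro k
    have := intervalIntegral.norm_integral_le_of_norm_le_const (hFnorm k)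
    simpa using this
  have hqapply : ∀ k (y : Fin n → 𝕜), q k (fun _ => y) =
      ∫ t in (0 : ℝ)..1, (t : 𝕜) ^ a * p k fun _ => scaleL 𝕜 w t y := by
    intro k y
    exact ((ContinuousMultilinearMap.apply 𝕜 (fun _ : Fin k => Fin n → 𝕜) 𝕜
      fun _ => y).intervalIntegral_comp_comm ((hFcont k).intervalIntegrable 0 1)).symm
  refine ⟨q, r, ?_, hr0, ?_⟩
  · refine q.le_radius_of_summable (Summable.of_nonneg_of_le (fun k => by positivity)
      (fun k => ?_) hsummable)
    exact mul_le_mul_of_nonneg_right (hqnorm k) (by positivity)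
  · intro y hy
    rw [zero_add]
    have hyr : ‖y‖ ≤ r := by
      rw [Metric.mem_eball, edist_zero_right] at hy
      exact_mod_cast (by simpa using hy.le : ‖y‖ₑ ≤ r)
    simp only [hqapply]
    refine intervalIntegral.hasSum_integral_of_dominated_convergence
      (fun k _ => ‖p k‖ * (r : ℝ) ^ k) ?_ ?_ ?_ intervalIntegrable_const ?_
    · intro k
      have : Continuous fun t : ℝ => (t : 𝕜) ^ a * p k fun _ => scaleL 𝕜 w t y := by
        have h₁ := (p k).cont.comp (continuous_pi fun _ : Fin k => continuous_scaleL_apply w y)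
        have h₂ : Continuous fun t : ℝ => (t : 𝕜) ^ a := by fun_prop
        exact h₂.mul h₁
      exact this.aestronglyMeasurable
    · refine fun k => Eventually.of_forall fun t ht => ?_
      have ht' := uIoc_zero_one_subset ht
      rw [norm_mul]
      refine (mul_le_of_le_one_left (norm_nonneg _) (norm_ofReal_pow_le_one ht' _)).trans ?_
      refine ((p k).le_opNorm _).trans ?_
      refine mul_le_mul_of_nonneg_left ?_ (norm_nonneg _)
      rw [Finset.prod_const, Finset.card_univ, Fintype.card_fin]
      exact pow_le_pow_left₀ (norm_nonneg _) ((norm_scaleL_apply_le w ht' y).trans hyr) k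
    · exact Eventually.of_forall fun t _ => hsummable
    · refine Eventually.of_forall fun t ht => ?_
      have ht' := uIoc_zero_one_subset ht
      have hmem : scaleL 𝕜 w t y ∈ Metric.eball (0 : Fin n → 𝕜) R := by
        rw [Metric.mem_eball, edist_zero_right] at hy ⊢
        refine lt_of_le_of_lt ?_ (hy.trans hrR)
        rw [enorm_le_iff_norm_le]
        exact norm_scaleL_apply_le w ht' y
      have := hp.hasSum hmem
      rw [zero_add] at this
      exact this.mul_left _

theorem eventually_contDiffAt_omega_avg (w : Fin n → ℕ) (a : ℕ) {φ : (Fin n → 𝕜) → 𝕜}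
    (hφ : ∀ᶠ x in 𝓝 0, ContDiffAt 𝕜 ω φ x) : ∀ᶠ x in 𝓝 0, ContDiffAt 𝕜 ω (avg w a φ) x := by
  have h := analyticAt_avg w a hφ.self_of_nhds.analyticAt
  filter_upwards [h.eventually_analyticAt] with x hx
  exact hx.contDiffAt

end AnalyticAverages

/-! ### Germs as a local calculus -/

section GermCalculus

variable {𝕜 : Type*} [RCLike 𝕜] {n : ℕ} {m : ℕ∞ω}

/-- The germ of a function of class `C^m` near `0`. -/
def toGerms (φ : (Fin n → 𝕜) → 𝕜) (hφ : ∀ᶠ x in 𝓝 0, ContDiffAt 𝕜 m φ x) : germs 𝕜 n m :=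
  ⟨(φ : Germ (𝓝 (0 : Fin n → 𝕜)) 𝕜), φ, hφ, rfl⟩

theorem exists_eq_toGerms (g : germs 𝕜 n m) : ∃ φ hφ, g = toGerms (m := m) φ hφ := by
  obtain ⟨_, φ, hφ, rfl⟩ := g
  exact ⟨φ, hφ, rfl⟩

theorem germsPartial_toGerms (hm : m + 1 ≤ m) (i : Fin n) (φ : (Fin n → 𝕜) → 𝕜)
    (hφ : ∀ᶠ x in 𝓝 0, ContDiffAt 𝕜 m φ x) :
    germsPartial 𝕜 n hm i (toGerms φ hφ) =
      toGerms (fpart i φ) (hφ.mono fun _ hx => contDiffAt_fpart hm i hx) := rfl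

theorem toGerms_congr {φ ψ : (Fin n → 𝕜) → 𝕜} {hφ : ∀ᶠ x in 𝓝 0, ContDiffAt 𝕜 m φ x}
    {hψ : ∀ᶠ x in 𝓝 0, ContDiffAt 𝕜 m ψ x} (h : φ =ᶠ[𝓝 0] ψ) : toGerms φ hφ = toGerms ψ hψ :=
  Subtype.ext (Germ.coe_eq.2 h)

theorem coe_toGerms (φ : (Fin n → 𝕜) → 𝕜) (hφ : ∀ᶠ x in 𝓝 0, ContDiffAt 𝕜 m φ x) :
    ((toGerms φ hφ : germs 𝕜 n m) : Germ (𝓝 (0 : Fin n → 𝕜)) 𝕜) = Germ.coeRingHom (𝓝 0) φ := rfl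

theorem coe_germsCoord (i : Fin n) :
    ((germsCoord 𝕜 n m i : germs 𝕜 n m) : Germ (𝓝 (0 : Fin n → 𝕜)) 𝕜) =
      Germ.coeRingHom (𝓝 0) fun x => x i := rfl

theorem coe_algebraMap_germs (c : 𝕜) :
    ((algebraMap 𝕜 (germs 𝕜 n m) c : germs 𝕜 n m) : Germ (𝓝 (0 : Fin n → 𝕜)) 𝕜) =
      Germ.coeRingHom (𝓝 0) fun _ => c := by
  change algebraMap 𝕜 (Germ (𝓝 (0 : Fin n → 𝕜)) 𝕜) c = _
  rw [Algebra.algebraMap_eq_smul_one]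
  refine congrArg (Germ.ofFun : ((Fin n → 𝕜) → 𝕜) → Germ (𝓝 (0 : Fin n → 𝕜)) 𝕜) (?_ : c • 1 = fun _ => c)
  funext x
  simp

theorem coe_natCast_germs (k : ℕ) :
    ((k : germs 𝕜 n m) : Germ (𝓝 (0 : Fin n → 𝕜)) 𝕜) = Germ.coeRingHom (𝓝 0) fun _ => (k : 𝕜) := by
  rw [← map_natCast (algebraMap 𝕜 (germs 𝕜 n m)), coe_algebraMap_germs]

theorem two_le_of_add_one_le (hm : m + 1 ≤ m) : 2 ≤ m := by
  have h₁ : 1 ≤ m := le_trans (by simp) hm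
  calc (2 : ℕ∞ω) = 1 + 1 := by norm_num
    _ ≤ m + 1 := by gcongr
    _ ≤ m := hm

theorem germsPartial_comm (hm : m + 1 ≤ m) (i j : Fin n) (g : germs 𝕜 n m) :
    germsPartial 𝕜 n hm i (germsPartial 𝕜 n hm j g) =
      germsPartial 𝕜 n hm j (germsPartial 𝕜 n hm i g) := by
  obtain ⟨φ, hφ, rfl⟩ := exists_eq_toGerms g
  rw [germsPartial_toGerms, germsPartial_toGerms, germsPartial_toGerms, germsPartial_toGerms]
  refine toGerms_congr ?_
  filter_upwards [hφ] with x hx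
  have hsymm := hx.isSymmSndFDerivAt (by
    rw [minSmoothness_of_isRCLikeNormedField]
    exact two_le_of_add_one_le hm)
  have hd : DifferentiableAt 𝕜 (fderiv 𝕜 φ) x :=
    (hx.fderiv_right hm).differentiableAt (ne_zero_of_add_one_le hm)
  have key : ∀ k l : Fin n, fpart k (fpart l φ) x =
      fderiv 𝕜 (fderiv 𝕜 φ) x (Pi.single k 1) (Pi.single l 1) := by
    intro k l
    change fderiv 𝕜 (fun y => fderiv 𝕜 φ y (Pi.single l 1)) x (Pi.single k 1) = _
    rw [fderiv_clm_apply hd (differentiableAt_const _)]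
    simp
  rw [key, key]
  exact hsymm _ _

/-- Stability of the class under averaging, `havg`, is the only input that differs between smooth
and analytic germs. -/
theorem isLocalCalculus_germs (hm : m + 1 ≤ m)
    (havg : ∀ (w : Fin n → ℕ) (a : ℕ) (φ : (Fin n → 𝕜) → 𝕜),
      (∀ᶠ x in 𝓝 0, ContDiffAt 𝕜 m φ x) → ∀ᶠ x in 𝓝 0, ContDiffAt 𝕜 m (avg w a φ) x) :
    IsLocalCalculus (fun i => germsPartial 𝕜 n hm i) (germsCoord 𝕜 n m) := by
  have h1 : 1 ≤ m := le_trans (by simp) hm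
  refine ⟨fun i j => ?_, ?_, fun w hw a g => ?_⟩
  · have h : germsPartial 𝕜 n hm i (germsCoord 𝕜 n m j) =
        algebraMap 𝕜 (germs 𝕜 n m) (Pi.single (M := fun _ => 𝕜) i 1 j) := by
      refine Subtype.ext ?_
      rw [coe_algebraMap_germs]
      refine Germ.coe_eq.2 (Eventually.of_forall fun x => ?_)
      change fderiv 𝕜 (fun y : Fin n → 𝕜 => y j) x (Pi.single i 1) = _
      rw [(hasFDerivAt_apply j x).fderiv]
      simp [Pi.single_apply]
    change germsPartial 𝕜 n hm i (germsCoord 𝕜 n m j) = _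
    rw [h, Pi.single_apply, Pi.single_apply]
    split_ifs <;> simp
  · refine ⟨AlgHom.mk (Germ.valueRingHom.comp (germs 𝕜 n m).val.toRingHom) ?_, fun i => rfl, ?_⟩
    · intro c
      change Germ.valueRingHom ((algebraMap 𝕜 (germs 𝕜 n m) c : germs 𝕜 n m) :
        Germ (𝓝 (0 : Fin n → 𝕜)) 𝕜) = c
      rw [coe_algebraMap_germs]
      rfl
    · intro g
      obtain ⟨φ, hφ, rfl⟩ := exists_eq_toGerms g
      obtain ⟨r, hr, hball⟩ := Metric.eventually_nhds_iff_ball.1 hφ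
      have hφi : ∀ i, ∀ᶠ x in 𝓝 0, ContDiffAt 𝕜 m (fpart i φ) x := fun i =>
        hφ.mono fun x hx => contDiffAt_fpart hm i hx
      refine ⟨fun i => toGerms (avg (fun _ => 1) 0 (fpart i φ)) (havg _ _ _ (hφi i)), ?_⟩
      refine Subtype.ext ?_
      change ((toGerms φ hφ : germs 𝕜 n m) : Germ (𝓝 (0 : Fin n → 𝕜)) 𝕜) =
        ((algebraMap 𝕜 (germs 𝕜 n m) (φ 0) + ∑ i, germsCoord 𝕜 n m i *
          toGerms (avg (fun _ => 1) 0 (fpart i φ)) (havg _ _ _ (hφi i)) : germs 𝕜 n m) :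
        Germ (𝓝 (0 : Fin n → 𝕜)) 𝕜)
      rw [Subalgebra.coe_add, AddSubmonoidClass.coe_finsetSum]
      simp only [Subalgebra.coe_mul, coe_toGerms, coe_germsCoord, coe_algebraMap_germs,
        ← map_mul, ← map_sum, ← map_add]
      refine Germ.coe_eq.2 ?_
      filter_upwards [Metric.ball_mem_nhds 0 hr] with x hx
      rw [hadamard_avg (fun x hx => (hball x hx).of_le h1) hx]
      simp [Finset.sum_apply]
  · obtain ⟨φ, hφ, rfl⟩ := exists_eq_toGerms g
    obtain ⟨r, hr, hball⟩ := Metric.eventually_nhds_iff_ball.1 hφ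
    refine ⟨toGerms (avg w a φ) (havg _ _ _ hφ), Subtype.ext ?_⟩
    simp only [germsPartial_toGerms]
    rw [Subalgebra.coe_add, AddSubmonoidClass.coe_finsetSum]
    simp only [Subalgebra.coe_mul, Subalgebra.coe_add, Subalgebra.coe_one, coe_toGerms,
      coe_germsCoord, coe_natCast_germs]
    simp only [← map_one (Germ.coeRingHom (R := 𝕜) (𝓝 (0 : Fin n → 𝕜))),
      ← map_mul, ← map_sum, ← map_add]
    refine Germ.coe_eq.2 ?_
    filter_upwards [Metric.ball_mem_nhds 0 hr] with x hx
    rw [← euler_avg hw a (fun x hx => (hball x hx).of_le h1) hx]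
    simp [Finset.sum_apply]

end GermCalculus

/-! ### The three kinds of functions -/

section Kinds

variable {𝕜 : Type*} [RCLike 𝕜] {n : ℕ}

theorem isLocalCalculus_kind (r : Kind) :
    IsLocalCalculus (K := 𝕜) (pd r 𝕜 n) (coord r 𝕜 n) :=
  match r with
  | .smooth => isLocalCalculus_germs (m := ∞) le_rfl fun w a _ => eventually_contDiffAt_infty_avg w a
  | .analytic =>
    isLocalCalculus_germs (m := ω) le_rfl fun w a _ => eventually_contDiffAt_omega_avg w a
  | .formal => isLocalCalculus_mvPowerSeries

theorem pd_comm (r : Kind) (i j : Fin n) (φ : Fn r 𝕜 n) :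
    pd r 𝕜 n i (pd r 𝕜 n j φ) = pd r 𝕜 n j (pd r 𝕜 n i φ) :=
  match r with
  | .smooth => germsPartial_comm (m := ∞) le_rfl i j φ
  | .analytic => germsPartial_comm (m := ω) le_rfl i j φ
  | .formal => mvPowerSeries_pderiv_comm i j φ

end Kinds

/-! ### Coefficients of `Λ` and of multiples of `ω` -/

section Coefficients

variable {𝕜 : Type*} [RCLike 𝕜] {n : ℕ}

theorem Lam_apply_stdFrame (r : Kind) (f : MvPolynomial (Fin n) 𝕜) :
    Lam r f (stdFrame (Fn r 𝕜 n) n) = poly r f := by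
  rw [Lam, unitMultiVector, AlternatingMap.smul_apply, det_stdFrame, smul_eq_mul, mul_one]

theorem smul_vol_apply_stdFrame {A : Type*} [CommRing A] (a : A) :
    (a • vol A n) (stdFrame A n) = a := by
  rw [vol, AlternatingMap.smul_apply, det_stdFrame, smul_eq_mul, mul_one]

end Coefficients

end NambuGerm

theorem mainTheorem7 {𝕜 : Type*} [RCLike 𝕜] (r : NambuGerm.Kind) (n : ℕ) (hn : 3 ≤ n)
    (w : Fin n → ℕ) (hw : ∀ i, 0 < w i) (N : ℤ)
    (f : MvPolynomial (Fin n) 𝕜) (hf : f ∈ NambuGerm.quasihom 𝕜 w N)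
    (hf0 : MvPolynomial.constantCoeff f = 0)
    (hfin : Module.Finite 𝕜 (NambuGerm.Milnor (NambuGerm.pd r 𝕜 n) (NambuGerm.poly r f))) :
    -- normal form of `n`-forms
    (∀ B : Set (Fin n →₀ ℕ), NambuGerm.IsMonomialBasis r f B →
      ∀ α : NambuGerm.Form (NambuGerm.Fn r 𝕜 n) n n,
        ∃! h : MvPolynomial (Fin n) 𝕜 × MvPolynomial (Fin n) 𝕜,
          h.1 ∈ NambuGerm.quasihom 𝕜 w (N - ∑ i, (w i : ℤ)) ∧
          h.2 ∈ NambuGerm.monomialSpan 𝕜 B ∧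
          α - NambuGerm.poly r (h.2 + f * h.1) • NambuGerm.vol (NambuGerm.Fn r 𝕜 n) n ∈
            NambuGerm.coboundaries (NambuGerm.pd r 𝕜 n) (NambuGerm.poly r f) ((n : ℤ) - 2) n) ∧
    -- the dimension of `H²_Λ`
    (Module.Finite 𝕜 (NambuGerm.H2 (NambuGerm.pd r 𝕜 n) (NambuGerm.Lam r f)) ∧
      Module.finrank 𝕜 (NambuGerm.H2 (NambuGerm.pd r 𝕜 n) (NambuGerm.Lam r f)) =
        Module.finrank 𝕜 (NambuGerm.Milnor (NambuGerm.pd r 𝕜 n) (NambuGerm.poly r f)) +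
        Module.finrank 𝕜 (NambuGerm.quasihom 𝕜 w (N - ∑ i, (w i : ℤ)))) ∧
    -- `H²_Λ` classifies the infinitesimal deformations of `Λ`
    (Function.Surjective (fun P : NambuGerm.InfDeformation (NambuGerm.Lam r f) =>
        NambuGerm.H2.mk (NambuGerm.pd r 𝕜 n) (NambuGerm.Lam r f) (NambuGerm.epsPart P.1)) ∧
      ∀ P P' : NambuGerm.InfDeformation (NambuGerm.Lam r f),
        NambuGerm.H2.mk (NambuGerm.pd r 𝕜 n) (NambuGerm.Lam r f) (NambuGerm.epsPart P.1) =
            NambuGerm.H2.mk (NambuGerm.pd r 𝕜 n) (NambuGerm.Lam r f) (NambuGerm.epsPart P'.1) ↔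
          NambuGerm.InfDeformation.Equivalent (NambuGerm.pd r 𝕜 n) P P') := by
  have hD := NambuGerm.isLocalCalculus_kind (𝕜 := 𝕜) (n := n) r
  have hn' : 0 < n := by omega
  refine ⟨fun B hB α => ?_, ?_, ?_, fun P P' =>
    NambuGerm.H2_mk_eq_iff_equivalent hD.partial_coord (NambuGerm.pd_comm r) P P'⟩
  · obtain ⟨hli, hspan⟩ := hB
    simp only [NambuGerm.mem_coboundaries_iff hn', AlternatingMap.sub_apply,
      NambuGerm.smul_vol_apply_stdFrame]
    exact hD.existsUnique_normalForm hn hw hf hf0 hfin B hli hspan _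
  · have e := NambuGerm.H2Equiv (NambuGerm.pd r 𝕜 n) (NambuGerm.Lam r f)
    rw [NambuGerm.Lam_apply_stdFrame] at e
    obtain ⟨hfinite, hrank⟩ := hD.finite_and_finrank_quotient hn hw hf hf0 hfin
    have := (show Module.Finite 𝕜 (NambuGerm.Fn r 𝕜 n ⧸ LinearMap.range
      (NambuGerm.twistedDiv (NambuGerm.pd r 𝕜 n) (NambuGerm.poly r f))) from hfinite)
    exact ⟨Module.Finite.equiv e.symm, e.finrank_eq.trans hrank⟩
  · exact (Submodule.mkQ_surjective _).comp (NambuGerm.surjective_epsPart _)
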